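/- Let $T>0$, let $\Omega\subset\mathbb R^3$ be a bounded domain of class $C^{3,1}$, and let $d_1=\gamma_0 g$ be a fixed Dirichlet datum on $\partial\Omega$, the trace of some $g\in H^2(\Omega;\mathbb R^3)$. Let $\{d_\delta\}_{\delta\in(0,1)}\subset L^2(0,T;H^2(\Omega;\mathbb R^3))$ be a family with $d_\delta(t)=d_1$ on $\partial\Omega$ (that is, $d_\delta(t)-g\in H^1_0(\Omega;\mathbb R^3)$) for all $\delta\in(0,1)$ and a.e. $t\in(0,T)$, and with $$\sup_{\delta\in(0,1)}\Big(\delta\,\|\Delta d_\delta\|_{L^\infty(0,T;L^2(\Omega))}^2+\|d_\delta\|_{L^\infty(0,T;H^1(\Omega))}^2\Big)<\infty .$$ Here $\nabla^2 d=[\partial_{x_k}\partial_{x_j}d_i]_{i,j,k=1}^3\in\mathbb R^{3\times3\times3}$, $|\cdot|$ is the Euclidean norm, and $S^{26}$ (where $26=3^3-1$) is the unit sphere of $\mathbb R^{3\times3\times3}$. Then there are a strictly decreasing sequence $\delta_k\in(0,1)$ with $\delta_k\to0$, a measurable family of finite positive measures $\mu_t$ on $\overline\Omega$, $t\in(0,T)$,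 with $$\operatorname*{ess\,sup}_{t\in(0,T)}\mu_t(\overline\Omega)<\infty ,$$ and a measurable family of probability measures $\nu^\mu_{(x,t)}$ on $S^{26}$, $(x,t)\in\overline\Omega\times(0,T)$, such that the following two assertions hold. (i) For every $f\in C(\overline\Omega\times[0,T]\times S^{26})$, $$\lim_{k\to\infty}\int_0^T\!\!\int_\Omega f\Big(x,t,\frac{\nabla^2 d_{\delta_k}(x,t)}{|\nabla^2 d_{\delta_k}(x,t)|}\Big)\,\delta_k|\nabla^2 d_{\delta_k}(x,t)|^2\,dx\,dt=\int_0^T\!\!\int_{\overline\Omega}\int_{S^{26}}f(x,t,\Gamma)\,\nu^\mu_{(x,t)}(d\Gamma)\,\mu_t(dx)\,dt ,$$ where the integrand on the left is $0$ wherever $\nabla^2 d_{\delta_k}=0$. (ii) For all $\phi\in C([0,T])$ and $\varphi\in C_c^\infty(\Omega)$, $$\lim_{k\to\infty}\int_0^T\!\!\int_\Omega\phi(t)\varphi(x)\,\delta_k|\nabla^2 d_{\delta_k}|^2\,dx\,dt=\int_0^T\!\!\int_{\overline\Omega}\phi(t)\varphi(x)\,\mu_t(dx)\,dt=\lim_{k\to\infty}\int_0^T\!\!\int_\Omega\phi(t)\varphi(x)\,\delta_k|\Delta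 d_{\delta_k}|^2\,dx\,dt .$$ -/

import Mathlib

open MeasureTheory ProbabilityTheory Set Filter Topology
open scoped ENNReal NNReal ContDiff

namespace DefectMeasure

/-- Vectors of `ℝ³` with the Euclidean norm. -/
abbrev Vec : Type := EuclideanSpace ℝ (Fin 3)

/-- Matrices in `ℝ^{3×3}` with the Frobenius norm. -/
abbrev Mat : Type := EuclideanSpace ℝ (Fin 3 × Fin 3)

/-- Third order tensors in `ℝ^{3×3×3}` with the Frobenius norm. -/
abbrev Tens : Type := EuclideanSpace ℝ (Fin 3 × Fin 3 × Fin 3)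

/-- The unit sphere `S^{26}` (`26 = 3³ - 1`) of `ℝ^{3×3×3}`. -/
abbrev TensSphere : Type := Metric.sphere (0 : Tens) 1

/-- The classical partial derivative `∂φ/∂x_j` of a scalar function on `ℝ³`. -/
noncomputable def pderiv (j : Fin 3) (φ : Vec → ℝ) (x : Vec) : ℝ :=
  fderiv ℝ φ x (EuclideanSpace.single j 1)

/-- The classical gradient `[∂φ_i/∂x_j]_{ij}` of a vector field on `ℝ³`. -/
noncomputable def classicalGrad (φ : Vec → Vec) (x : Vec) : Mat :=
  WithLp.toLp 2 fun p => pderiv p.2 (fun y => φ y p.1) x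

/-- `φ ∈ C_c^∞(Ω; F)`, extended by zero to the whole space. -/
structure IsTestFunction {F : Type*} [NormedAddCommGroup F] [NormedSpace ℝ F]
    (Ω : Set Vec) (φ : Vec → F) : Prop where
  smooth : ContDiff ℝ ∞ φ
  hasCompactSupport : HasCompactSupport φ
  tsupport_subset : tsupport φ ⊆ Ω

/-- `Ω ⊆ ℝ³` is a bounded domain of class `C^{3,1}`: a bounded, nonempty, connected open set which,
near each of its boundary points and in suitable Cartesian coordinates, is the region strictly above
the graph of a `C^{3,1}` function of two variables. -/
structure IsBoundedC31Domain (Ω : Set Vec) : Prop where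
  isOpen : IsOpen Ω
  isConnected : IsConnected Ω
  isBounded : Bornology.IsBounded Ω
  boundary : ∀ x₀ ∈ frontier Ω,
    ∃ (e : Vec ≃ᵃⁱ[ℝ] Vec) (r : ℝ) (ψ : EuclideanSpace ℝ (Fin 2) → ℝ) (L : ℝ≥0),
      0 < r ∧ ContDiff ℝ 3 ψ ∧ LipschitzWith L (iteratedFDeriv ℝ 3 ψ) ∧
      ∀ x ∈ Metric.ball x₀ r, x ∈ Ω ↔ ψ !₂[e x 0, e x 1] < e x 2

/-- `v` is the weak partial derivative `∂u/∂x_j` of `u` in `Ω`. -/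
structure HasWeakPDeriv (Ω : Set Vec) (j : Fin 3) (u v : Vec → ℝ) : Prop where
  locallyIntegrable : LocallyIntegrableOn u Ω
  locallyIntegrable_deriv : LocallyIntegrableOn v Ω
  integral_eq : ∀ φ : Vec → ℝ, IsTestFunction Ω φ →
    ∫ x in Ω, u x * pderiv j φ x = - ∫ x in Ω, v x * φ x

/-- `Du = [∂u_i/∂x_j]_{ij}` and `D2u = [∂²u_i/∂x_j∂x_k]_{ijk}` are the weak gradient and the
weak second gradient of the vector field `u` in `Ω`. -/
structure HasWeakDerivs (Ω : Set Vec) (u : Vec → Vec) (Du : Vec → Mat) (D2u : Vec → Tens) :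
    Prop where
  grad : ∀ i j, HasWeakPDeriv Ω j (fun x => u x i) (fun x => Du x (i, j))
  hess : ∀ i j k, HasWeakPDeriv Ω k (fun x => Du x (i, j)) (fun x => D2u x (i, j, k))

/-- `u ∈ H²(Ω; ℝ³)`, with weak gradient `Du` and weak second gradient `D2u`. -/
structure IsH2 (Ω : Set Vec) (u : Vec → Vec) (Du : Vec → Mat) (D2u : Vec → Tens) : Prop where
  derivs : HasWeakDerivs Ω u Du D2u
  memLp : MemLp u 2 (volume.restrict Ω)
  memLp_grad : MemLp Du 2 (volume.restrict Ω)
  memLp_hess : MemLp D2u 2 (volume.restrict Ω)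

/-- `w ∈ H¹₀(Ω; ℝ³)` with weak gradient `Dw`: `w` is the limit in `H¹` of fields in
`C_c^∞(Ω; ℝ³)`. -/
def IsH10 (Ω : Set Vec) (w : Vec → Vec) (Dw : Vec → Mat) : Prop :=
  ∃ φ : ℕ → Vec → Vec, (∀ n, IsTestFunction Ω (φ n)) ∧
    Tendsto (fun n => eLpNorm (φ n - w) 2 (volume.restrict Ω)) atTop (𝓝 0) ∧
    Tendsto (fun n => eLpNorm (classicalGrad (φ n) - Dw) 2 (volume.restrict Ω)) atTop (𝓝 0)

/-- `u ∈ L²(0,T; H²(Ω; ℝ³))`, where `u t x` is the value at time `t` and position `x`; the spatial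
weak gradient and second gradient of `u t` are `Du t` and `D2u t` for almost every `t`. -/
structure IsL2H2 (T : ℝ) (Ω : Set Vec) (u : ℝ → Vec → Vec) (Du : ℝ → Vec → Mat)
    (D2u : ℝ → Vec → Tens) : Prop where
  derivs : ∀ᵐ t ∂(volume.restrict (Ioo 0 T)), HasWeakDerivs Ω (u t) (Du t) (D2u t)
  memLp : MemLp (fun p : ℝ × Vec => u p.1 p.2) 2
    ((volume.restrict (Ioo 0 T)).prod (volume.restrict Ω))
  memLp_grad : MemLp (fun p : ℝ × Vec => Du p.1 p.2) 2
    ((volume.restrict (Ioo 0 T)).prod (volume.restrict Ω))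
  memLp_hess : MemLp (fun p : ℝ × Vec => D2u p.1 p.2) 2
    ((volume.restrict (Ioo 0 T)).prod (volume.restrict Ω))

/-- The Laplacian `(∑_j Γ_{ijj})_i` read off from a second gradient `Γ`. -/
noncomputable def lap (Γ : Tens) : Vec := WithLp.toLp 2 fun i => ∑ j, Γ (i, j, j)

/-- The squared norm of `L²(Ω; F)`, as an extended nonnegative number. -/
noncomputable def sqNormL2 {F : Type*} [NormedAddCommGroup F] (Ω : Set Vec) (u : Vec → F) : ℝ≥0∞ :=
  ∫⁻ x in Ω, ‖u x‖ₑ ^ 2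

/-- The essential supremum over `t ∈ (0,T)`. -/
noncomputable def essSupTime (T : ℝ) (g : ℝ → ℝ≥0∞) : ℝ≥0∞ :=
  essSup g (volume.restrict (Ioo 0 T))

/-- A measurable family of finite positive measures `μ_t` on `closure Ω`, with `t ∈ (0,T)`
(parametrized over all real `t` for convenience), and a measurable family of probability measures
`ν_{(x,t)}` on the unit sphere of `ℝ^{3×3×3}`, with masses `μ_t(closure Ω)` essentially bounded. -/
structure IsDefectMeasure (T : ℝ) (Ω : Set Vec) (μ : Kernel ℝ Vec)
    (ν : Kernel (Vec × ℝ) TensSphere) : Prop where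
  finite : ∀ t, IsFiniteMeasure (μ t)
  supported : ∀ t, μ t (closure Ω)ᶜ = 0
  essBounded : essSupTime T (fun t => μ t (closure Ω)) < ⊤
  markov : IsMarkovKernel ν

end DefectMeasure

open DefectMeasure

/-!
The family `d δ` has fixed boundary values and `√δ Δ(d δ)` is bounded in `L^∞(0,T; L²)`. Everything
rests on two estimates for fields in `H²(Ω)` and one compactness argument.

*Bound on the second gradient* (`exists_integral_norm_sq_hess_le`). If `w` vanishes on `∂Ω`, then
`‖∇²w‖ ≤ C (‖Δw‖ + ‖∇w‖)` in `L²(Ω)`. No flattening of the boundary, no trace operator and no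
solvability theory is used. Near a boundary point let `Ω = {ρ > 0}` with `ρ` of class `C³`, and let
`τ` be a compactly supported `C²` field tangential to all level sets of `ρ`. Then `u = τ · ∇w`
extended by zero is in `H¹(ℝ³)` (`integral_tangDeriv_mul_pderiv`): the divergence theorem for
tangential fields holds without boundary term, because a cutoff function of `ρ` is constant along
`τ` (`integral_mul_tangential`), and the only other fact needed is
`∫ (∂_i w ∂_k g - ∂_k w ∂_i g) = 0`, which passes to the limit from test functions
(`IsH10.hasZeroTangentialTrace`). Translating into `Ω` and mollifying makes `u` an admissible test
function, and the symmetry of second derivatives turns `∫ |∇u|²` into an integral of `Δw` and `∇w`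
against `∇u` (`integral_hess_mul_tangDerivGrad`, `integral_sq_tangDerivGrad_le`). This bounds all
second derivatives in which one direction is tangential; the remaining one is read off from `Δw`
(`sum_sq_hess_le`). A finite cover of `closure Ω` concludes.

*Interior comparison* (`abs_integral_mul_norm_sq_hess_sub_le`). `|∇²u|² - |Δu|²` is a divergence of
terms of the form `∇²u · ∇u`, so against a test function `φ` it is at most
`C_φ ‖∇²u‖ ‖∇u‖`. Multiplied with `δ` this is `O(√δ)`, so that the limits of `δ |∇²u|²` and of
`δ |Δu|²` agree in the interior.

*Compactness* (`exists_subseq_isDefectMeasure`). The images of `δ |∇²d|² dx dt` under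
`(t, x) ↦ ((t, x), ∇²d / |∇²d|)` are bounded measures on the compact set
`[0,T] × closure Ω × S²⁶`; a subsequence converges weakly. By the first estimate their time
marginals have uniformly bounded densities, hence so has the time marginal of the limit, and
disintegrating the limit twice gives `μ` and `ν` (`exists_isDefectMeasure`).
-/

namespace DefectMeasure

open scoped Pointwise

/-! ### Partial derivatives of continuously differentiable functions -/

lemma continuous_pderiv {f : Vec → ℝ} (hf : ContDiff ℝ 1 f) (j : Fin 3) :
    Continuous (pderiv j f) :=
  (hf.continuous_fderiv one_ne_zero).clm_apply continuous_const

lemma contDiff_pderiv {n m : ℕ∞ω} {f : Vec → ℝ} (hf : ContDiff ℝ n f) (h : m + 1 ≤ n)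
    (j : Fin 3) : ContDiff ℝ m (pderiv j f) :=
  (hf.fderiv_right h).clm_apply contDiff_const

lemma pderiv_eq_zero_of_notMem {f : Vec → ℝ} {j : Fin 3} {x : Vec} (hx : x ∉ tsupport f) :
    pderiv j f x = 0 := by
  rw [pderiv, fderiv_of_notMem_tsupport (𝕜 := ℝ) hx, zero_apply]

lemma tsupport_pderiv_subset (f : Vec → ℝ) (j : Fin 3) : tsupport (pderiv j f) ⊆ tsupport f :=
  closure_minimal (fun _ hx => by_contra fun h => hx (pderiv_eq_zero_of_notMem h))
    (isClosed_tsupport f)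

lemma hasCompactSupport_pderiv {f : Vec → ℝ} (hf : HasCompactSupport f) (j : Fin 3) :
    HasCompactSupport (pderiv j f) :=
  hf.mono' (subset_closure.trans (tsupport_pderiv_subset f j))

lemma pderiv_mul {f g : Vec → ℝ} (hf : ContDiff ℝ 1 f) (hg : ContDiff ℝ 1 g) (j : Fin 3)
    (x : Vec) : pderiv j (fun y => f y * g y) x = pderiv j f x * g x + f x * pderiv j g x := by
  simp only [pderiv]
  rw [fderiv_fun_mul (hf.differentiable one_ne_zero x) (hg.differentiable one_ne_zero x)]
  simp
  ring

lemma pderiv_comm {f : Vec → ℝ} (hf : ContDiff ℝ 2 f) (i j : Fin 3) (x : Vec) :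
    pderiv i (pderiv j f) x = pderiv j (pderiv i f) x := by
  have h1 : ∀ a b : Fin 3, pderiv a (pderiv b f) x =
      fderiv ℝ (fderiv ℝ f) x (EuclideanSpace.single a 1) (EuclideanSpace.single b 1) := by
    intro a b
    have hd : DifferentiableAt ℝ (fderiv ℝ f) x :=
      (hf.fderiv_right (m := 1) (by norm_num)).differentiable one_ne_zero x
    unfold pderiv
    rw [fderiv_clm_apply hd (differentiableAt_const _)]
    simp
  rw [h1, h1]
  exact (hf.contDiffAt.isSymmSndFDerivAt (by simp)) _ _

/-- Integration by parts on the whole space when one factor has compact support. -/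
lemma integral_mul_pderiv {f g : Vec → ℝ} (hf : ContDiff ℝ 1 f) (hg : ContDiff ℝ 1 g)
    (hs : HasCompactSupport g) (j : Fin 3) :
    ∫ x, f x * pderiv j g x = - ∫ x, pderiv j f x * g x := by
  refine integral_mul_fderiv_eq_neg_fderiv_mul_of_integrable ?_ ?_ ?_
    (fun x _ => hf.differentiable one_ne_zero x) (fun x _ => hg.differentiable one_ne_zero x)
  · exact ((continuous_pderiv hf j).mul hg.continuous).integrable_of_hasCompactSupport
      (hs.mul_left (f := pderiv j f))
  · exact (hf.continuous.mul (continuous_pderiv hg j)).integrable_of_hasCompactSupport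
      ((hasCompactSupport_pderiv hs j).mul_left)
  · exact (hf.continuous.mul hg.continuous).integrable_of_hasCompactSupport hs.mul_left

/-! ### Square integrable functions -/

lemma _root_.MeasureTheory.MemLp.mul_hasCompactSupport {μ : Measure Vec} {f c : Vec → ℝ}
    (hf : MemLp f 2 μ) (hc : Continuous c) (hs : HasCompactSupport c) :
    MemLp (fun x => c x * f x) 2 μ := by
  obtain ⟨C, hC⟩ := hc.bounded_above_of_compact_support hs
  exact hf.mul' (memLp_top_of_bound hc.aestronglyMeasurable C (ae_of_all _ hC))

lemma memLp_of_hasCompactSupport {c : Vec → ℝ} (hc : Continuous c) (hs : HasCompactSupport c) :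
    MemLp c 2 := hc.memLp_of_hasCompactSupport hs

lemma continuous_integral_mul_translate {G V : Vec → ℝ} (hG : MemLp G 2) (hV : MemLp V 2) :
    Continuous fun y : Vec => ∫ x, G x * V (x - y) := by
  have hmp : ∀ y : Vec, MeasurePreserving (fun x : Vec => x - y) := fun y =>
    measurePreserving_sub_right volume y
  let τ : Vec → C(Vec, Vec) := fun y => ⟨fun x => x - y, by fun_prop⟩
  have hτ : Continuous τ := ContinuousMap.continuous_of_continuous_uncurry _ (by
    simp only [Function.uncurry_def, τ, ContinuousMap.coe_mk]; fun_prop)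
  have h : Continuous fun y => inner ℝ (hG.toLp G)
      (Lp.compMeasurePreserving (τ y) (hmp y) (hV.toLp V)) :=
    continuous_const.inner (continuous_const.compMeasurePreservingLp hτ hmp (by simp))
  refine h.congr fun y => ?_
  rw [L2.inner_def]
  refine integral_congr_ae ?_
  have h1 := Lp.coeFn_compMeasurePreserving (hV.toLp V) (hmp y)
  have h2 := (hmp y).quasiMeasurePreserving.ae_eq_comp hV.coeFn_toLp
  filter_upwards [hG.coeFn_toLp, h1, h2] with x hx1 hx2 hx3
  have : (Lp.compMeasurePreserving (τ y) (hmp y) (hV.toLp V)) x = V (x - y) := hx2.trans hx3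
  rw [this, hx1]
  simp [mul_comm]

/-- The mollification of `V` with the smooth kernel `k`. -/
noncomputable def mollify (k V : Vec → ℝ) (x : Vec) : ℝ := ∫ y, V y * k (x - y)

lemma mollify_eq_convolution (k V : Vec → ℝ) :
    mollify k V = convolution V k (ContinuousLinearMap.mul ℝ ℝ) volume := rfl

lemma contDiff_mollify {k V : Vec → ℝ} (hk : ContDiff ℝ ∞ k) (hks : HasCompactSupport k)
    (hV : LocallyIntegrable V) : ContDiff ℝ ∞ (mollify k V) := by
  rw [mollify_eq_convolution]
  exact hks.contDiff_convolution_right (n := ⊤) _ hV hk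

lemma pderiv_mollify {k V : Vec → ℝ} (hk : ContDiff ℝ ∞ k) (hks : HasCompactSupport k)
    (hV : LocallyIntegrable V) (j : Fin 3) (x : Vec) :
    pderiv j (mollify k V) x = mollify (pderiv j k) V x := by
  have h := hks.hasFDerivAt_convolution_right (ContinuousLinearMap.mul ℝ ℝ) hV
    (hk.of_le (by simp)) x
  rw [pderiv, mollify_eq_convolution, h.fderiv, convolution_def,
    ContinuousLinearMap.integral_apply]
  · rfl
  · exact (hks.fderiv ℝ).convolutionExists_right _ hV
      (hk.continuous_fderiv (by simp)) x

lemma integral_mul_mollify {G V k : Vec → ℝ} (hG : MemLp G 2) (hV : MemLp V 2)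
    (hk : Continuous k) (hks : HasCompactSupport k) :
    ∫ x, G x * mollify k V x = ∫ y, k y * ∫ x, G x * V (x - y) := by
  have hm : ∀ x, mollify k V x = ∫ y, V (x - y) * k y := fun x => by
    rw [mollify, ← integral_sub_left_eq_self (fun y => V y * k (x - y)) volume x]
    simp
  have hmV : AEStronglyMeasurable (fun p : Vec × Vec => V (p.1 - p.2)) (volume.prod volume) :=
    hV.1.comp_quasiMeasurePreserving (quasiMeasurePreserving_sub volume volume)
  have hmG : AEStronglyMeasurable (fun p : Vec × Vec => G p.1) (volume.prod volume) :=
    hG.1.comp_fst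
  have hmk : AEStronglyMeasurable (fun p : Vec × Vec => k p.2) (volume.prod volume) :=
    (hk.comp continuous_snd).aestronglyMeasurable
  have hG2 : Integrable (fun p : Vec × Vec => G p.1 ^ 2 * k p.2) (volume.prod volume) :=
    hG.integrable_sq.mul_prod (hk.integrable_of_hasCompactSupport (μ := volume) hks)
  have hV2 : Integrable (fun p : Vec × Vec => V (p.1 - p.2) ^ 2 * k p.2)
      (volume.prod volume) := by
    have h0 := hV.integrable_sq.mul_prod (hk.integrable_of_hasCompactSupport (μ := volume) hks)
    have := (measurePreserving_sub_prod (G := Vec) volume volume).integrable_comp_of_integrable h0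
    exact this
  have hint : Integrable (fun p : Vec × Vec => G p.1 * (V (p.1 - p.2) * k p.2))
      (volume.prod volume) := by
    refine (hG2.norm.add hV2.norm).mono' (hmG.mul (hmV.mul hmk)) (ae_of_all _ fun p => ?_)
    simp only [norm_mul, Real.norm_eq_abs, Pi.add_apply, norm_pow, sq_abs]
    have := abs_nonneg (k p.2)
    have h2 : |G p.1| * |V (p.1 - p.2)| ≤ G p.1 ^ 2 + V (p.1 - p.2) ^ 2 := by
      nlinarith [sq_nonneg (|G p.1| - |V (p.1 - p.2)|), sq_abs (G p.1), sq_abs (V (p.1 - p.2)),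
        sq_nonneg (G p.1), sq_nonneg (V (p.1 - p.2))]
    nlinarith
  calc ∫ x, G x * mollify k V x = ∫ x, ∫ y, G x * (V (x - y) * k y) := by
        simp_rw [hm, integral_const_mul]
    _ = ∫ y, ∫ x, G x * (V (x - y) * k y) := integral_integral_swap hint
    _ = _ := by
        congr 1; ext y
        rw [← integral_const_mul]
        congr 1; ext x; ring

/-- Mollifications converge weakly in `L²` when the kernels concentrate at the origin; the kernels
need not be centred at the origin. -/
lemma tendsto_integral_mul_mollify {G V : Vec → ℝ} (hG : MemLp G 2) (hV : MemLp V 2)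
    {c : ℕ → Vec} (k : ∀ n, ContDiffBump (c n)) (hc : Tendsto c atTop (𝓝 0))
    (hr : Tendsto (fun n => (k n).rOut) atTop (𝓝 0)) :
    Tendsto (fun n => ∫ x, G x * mollify ((k n).normed volume) V x) atTop
      (𝓝 (∫ x, G x * V x)) := by
  set F : Vec → ℝ := fun y => ∫ x, G x * V (x - y) with hF
  have hFc : Continuous F := continuous_integral_mul_translate hG hV
  have h0 : ∫ x, G x * V x = F 0 := by simp [hF]
  have hi : ∀ n, ∫ x, G x * mollify ((k n).normed volume) V x =
      ∫ y, (k n).normed volume y * F y := fun n =>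
    integral_mul_mollify hG hV (k n).continuous_normed (k n).hasCompactSupport_normed
  simp_rw [hi, h0]
  rw [Metric.tendsto_atTop]
  intro ε hε
  obtain ⟨η, hη, hηF⟩ := Metric.continuousAt_iff.1 (hFc.continuousAt (x := 0)) (ε / 2) (by positivity)
  have e1 := (tendsto_norm_zero.comp hc).add hr
  simp only [add_zero] at e1
  obtain ⟨N, hN⟩ := eventually_atTop.1 (e1.eventually (gt_mem_nhds hη))
  refine ⟨N, fun n hn => ?_⟩
  have hint : Integrable fun y => (k n).normed volume y * F y :=
    ((k n).continuous_normed.mul hFc).integrable_of_hasCompactSupport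
      (k n).hasCompactSupport_normed.mul_right
  have hint' : Integrable fun y => (k n).normed volume y * F 0 :=
    (k n).integrable_normed.mul_const _
  have e2 : (∫ y, (k n).normed volume y * F y) - F 0 =
      ∫ y, (k n).normed volume y * (F y - F 0) := by
    simp_rw [mul_sub]
    rw [integral_sub hint hint', integral_mul_const, (k n).integral_normed, one_mul]
  rw [Real.dist_eq, e2]
  have hb : ∀ y, ‖(k n).normed volume y * (F y - F 0)‖ ≤ (k n).normed volume y * (ε / 2) := by
    intro y
    rw [norm_mul, Real.norm_of_nonneg ((k n).nonneg_normed y)]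
    by_cases hy : y ∈ Metric.ball (c n) (k n).rOut
    · refine mul_le_mul_of_nonneg_left ?_ ((k n).nonneg_normed y)
      rw [← dist_eq_norm (F y)]
      refine (hηF ?_).le
      rw [dist_zero_right]
      have := hN n hn
      simp only [Function.comp_apply] at this
      have h3 : ‖y‖ ≤ ‖c n‖ + dist y (c n) := by
        rw [dist_eq_norm]; simpa using norm_add_le (c n) (y - c n)
      have := Metric.mem_ball.1 hy
      linarith
    · have : (k n).normed volume y = 0 := by
        rw [← Function.notMem_support, (k n).support_normed_eq]; exact hy
      simp [this]
  calc ‖∫ y, (k n).normed volume y * (F y - F 0)‖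
      ≤ ∫ y, (k n).normed volume y * (ε / 2) :=
        norm_integral_le_of_norm_le ((k n).integrable_normed.mul_const _) (ae_of_all _ hb)
    _ = ε / 2 := by rw [integral_mul_const, (k n).integral_normed, one_mul]
    _ < ε := by linarith

/-! ### Weak derivatives and approximation by test functions -/

lemma integral_indicator_mul {Ω : Set Vec} (hΩ : MeasurableSet Ω) (u φ : Vec → ℝ) :
    ∫ x, Ω.indicator u x * φ x = ∫ x in Ω, u x * φ x := by
  rw [← integral_indicator hΩ]
  congr 1; ext x
  by_cases hx : x ∈ Ω <;> simp [hx]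

lemma integral_indicator_mul_indicator {Ω : Set Vec} (hΩ : MeasurableSet Ω) (u v : Vec → ℝ) :
    ∫ x, Ω.indicator u x * Ω.indicator v x = ∫ x in Ω, u x * v x := by
  rw [integral_indicator_mul hΩ]
  exact setIntegral_congr_fun hΩ fun x hx => by simp only [indicator_of_mem hx]

lemma memLp_indicator {Ω : Set Vec} (hΩ : MeasurableSet Ω) {u : Vec → ℝ}
    (hu : MemLp u 2 (volume.restrict Ω)) : MemLp (Ω.indicator u) 2 :=
  (memLp_indicator_iff_restrict hΩ).2 hu

lemma pderiv_comp_sub_left {k : Vec → ℝ} (hk : ContDiff ℝ 1 k) (j : Fin 3) (x y : Vec) :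
    pderiv j (fun y => k (x - y)) y = - pderiv j k (x - y) := by
  unfold pderiv
  have h := (hk.differentiable one_ne_zero (x - y)).hasFDerivAt.comp y
    ((hasFDerivAt_const x y).sub (hasFDerivAt_id y))
  have h2 : fderiv ℝ (fun y => k (x - y)) y = _ := h.fderiv
  rw [h2]
  simp

/-- A function `U ∈ H¹(ℝ³)` vanishing off a compact set `K` is a weak `H¹` limit of test functions
in `Ω`, if `K` can be moved into `Ω` by small translations `c n`, with room `r n` to mollify. -/
lemma exists_isTestFunction_tendsto {Ω K : Set Vec} (hK : IsCompact K) {c : ℕ → Vec} {r : ℕ → ℝ}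
    (hc : Tendsto c atTop (𝓝 0)) (hr : ∀ n, 0 < r n) (hr0 : Tendsto r atTop (𝓝 0))
    (hsub : ∀ n, K + Metric.closedBall (c n) (r n) ⊆ Ω)
    {U : Vec → ℝ} {V : Fin 3 → Vec → ℝ} (hU : MemLp U 2) (hV : ∀ j, MemLp (V j) 2)
    (hw : ∀ j φ, ContDiff ℝ ∞ φ → HasCompactSupport φ →
      ∫ x, U x * pderiv j φ x = - ∫ x, V j x * φ x)
    (hUK : ∀ x ∉ K, U x = 0) :
    ∃ φ : ℕ → Vec → ℝ, (∀ n, IsTestFunction Ω (φ n)) ∧ ∀ G : Vec → ℝ, MemLp G 2 →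
      Tendsto (fun n => ∫ x, G x * φ n x) atTop (𝓝 (∫ x, G x * U x)) ∧
      ∀ j, Tendsto (fun n => ∫ x, G x * pderiv j (φ n) x) atTop (𝓝 (∫ x, G x * V j x)) := by
  let k : ∀ n, ContDiffBump (c n) := fun n => ⟨r n / 2, r n, by linarith [hr n], by linarith [hr n]⟩
  have hUl : LocallyIntegrable U := hU.locallyIntegrable (by norm_num)
  have hkC : ∀ n, ContDiff ℝ ∞ ((k n).normed volume) := fun n => (k n).contDiff_normed
  have hkS : ∀ n, HasCompactSupport ((k n).normed volume) := fun n => (k n).hasCompactSupport_normed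
  have hts : ∀ n, tsupport (mollify ((k n).normed volume) U) ⊆ K + Metric.closedBall (c n) (r n) := by
    intro n
    refine closure_minimal ?_ (hK.add (isCompact_closedBall _ _)).isClosed
    rw [mollify_eq_convolution]
    refine (support_convolution_subset _).trans (add_subset_add ?_ ?_)
    · exact fun x hx => by_contra fun h => hx (hUK x h)
    · rw [(k n).support_normed_eq]; exact Metric.ball_subset_closedBall
  have hder : ∀ n j x, pderiv j (mollify ((k n).normed volume) U) x =
      mollify ((k n).normed volume) (V j) x := by
    intro n j x
    rw [pderiv_mollify (hkC n) (hkS n) hUl]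
    have h1 := hw j (fun y => (k n).normed volume (x - y))
      ((hkC n).comp (contDiff_const.sub contDiff_id))
      ((hkS n).comp_homeomorph (Homeomorph.subLeft x))
    simp_rw [pderiv_comp_sub_left ((hkC n).of_le (by simp))] at h1
    simp only [mul_neg, integral_neg, neg_inj] at h1
    exact h1
  refine ⟨fun n => mollify ((k n).normed volume) U, fun n => ⟨contDiff_mollify (hkC n) (hkS n) hUl,
    (hK.add (isCompact_closedBall _ _)).of_isClosed_subset (isClosed_tsupport _) (hts n),
    (hts n).trans (hsub n)⟩, fun G hG => ⟨tendsto_integral_mul_mollify hG hU k hc hr0, fun j => ?_⟩⟩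
  simp_rw [hder]
  exact tendsto_integral_mul_mollify hG (hV j) k hc hr0

lemma exists_isTestFunction_tendsto_of_subset {Ω K : Set Vec} (hΩ : IsOpen Ω) (hK : IsCompact K)
    (hsub : K ⊆ Ω)
    {U : Vec → ℝ} {V : Fin 3 → Vec → ℝ} (hU : MemLp U 2) (hV : ∀ j, MemLp (V j) 2)
    (hw : ∀ j φ, ContDiff ℝ ∞ φ → HasCompactSupport φ →
      ∫ x, U x * pderiv j φ x = - ∫ x, V j x * φ x)
    (hUK : ∀ x ∉ K, U x = 0) :
    ∃ φ : ℕ → Vec → ℝ, (∀ n, IsTestFunction Ω (φ n)) ∧ ∀ G : Vec → ℝ, MemLp G 2 →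
      Tendsto (fun n => ∫ x, G x * φ n x) atTop (𝓝 (∫ x, G x * U x)) ∧
      ∀ j, Tendsto (fun n => ∫ x, G x * pderiv j (φ n) x) atTop (𝓝 (∫ x, G x * V j x)) := by
  obtain ⟨δ, hδ, hδΩ⟩ := hK.exists_cthickening_subset_open hΩ hsub
  refine exists_isTestFunction_tendsto hK (c := fun _ => 0) (r := fun n : ℕ => δ / (n + 1))
    tendsto_const_nhds (fun n => by positivity) ?_ (fun n => ?_) hU hV hw hUK
  · exact tendsto_const_div_atTop_nhds_zero_nat δ |>.comp (tendsto_add_atTop_nat 1) |>.congr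
      fun n => by simp
  · rw [hK.add_closedBall_zero (by positivity)]
    refine (Metric.cthickening_mono ?_ K).trans hδΩ
    exact div_le_self hδ.le (by linarith [(Nat.cast_nonneg n : (0 : ℝ) ≤ n)])

/-- A square integrable weak derivative may be tested with `C¹` functions of compact support. -/
lemma HasWeakPDeriv.integral_eq_of_contDiff_one {Ω : Set Vec} (hΩ : IsOpen Ω) {j : Fin 3}
    {u v : Vec → ℝ} (h : HasWeakPDeriv Ω j u v) (hu : MemLp u 2 (volume.restrict Ω))
    (hv : MemLp v 2 (volume.restrict Ω)) {θ : Vec → ℝ} (hθ : ContDiff ℝ 1 θ)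
    (hs : HasCompactSupport θ) (hsub : tsupport θ ⊆ Ω) :
    ∫ x in Ω, u x * pderiv j θ x = - ∫ x in Ω, v x * θ x := by
  obtain ⟨φ, hφ, hlim⟩ := exists_isTestFunction_tendsto_of_subset (U := θ)
    (V := fun j => pderiv j θ) hΩ hs hsub (memLp_of_hasCompactSupport hθ.continuous hs)
    (fun j => memLp_of_hasCompactSupport (continuous_pderiv hθ j) (hasCompactSupport_pderiv hs j))
    (fun j φ hφ hφs => integral_mul_pderiv hθ (hφ.of_le (by simp)) hφs j)
    (fun x hx => image_eq_zero_of_notMem_tsupport hx)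
  have hm := hΩ.measurableSet
  have h1 := (hlim _ (memLp_indicator hm hu)).2 j
  have h2 := (hlim _ (memLp_indicator hm hv)).1.neg
  simp_rw [integral_indicator_mul hm] at h1 h2
  exact tendsto_nhds_unique (h1.congr fun n => h.integral_eq _ (hφ n)) h2

lemma IsTestFunction.pderiv {Ω : Set Vec} {φ : Vec → ℝ} (h : IsTestFunction Ω φ) (j : Fin 3) :
    IsTestFunction Ω (pderiv j φ) :=
  ⟨contDiff_pderiv h.smooth (by simp) j, hasCompactSupport_pderiv h.hasCompactSupport j,
    (tsupport_pderiv_subset φ j).trans h.tsupport_subset⟩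

/-- The weak second derivatives are symmetric. -/
lemma weakHessian_symm {Ω : Set Vec} (hΩ : IsOpen Ω) {w p q a b : Vec → ℝ} {i j : Fin 3}
    (hp : HasWeakPDeriv Ω i w p) (hq : HasWeakPDeriv Ω j w q)
    (ha : HasWeakPDeriv Ω j p a) (hb : HasWeakPDeriv Ω i q b) :
    ∀ᵐ x ∂(volume.restrict Ω), a x = b x := by
  have key : ∀ φ : Vec → ℝ, IsTestFunction Ω φ → ∫ x in Ω, a x * φ x = ∫ x in Ω, b x * φ x := by
    intro φ hφ
    have hd := hφ.pderiv
    have e1 := ha.integral_eq φ hφ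
    have e2 := hb.integral_eq φ hφ
    have e3 := hp.integral_eq _ (hd j)
    have e4 := hq.integral_eq _ (hd i)
    simp_rw [pderiv_comm (hφ.smooth.of_le (by norm_cast)) i j] at e3
    linarith
  have hloc := ha.locallyIntegrable_deriv.sub hb.locallyIntegrable_deriv
  have h0 := hΩ.ae_eq_zero_of_integral_contDiff_smul_eq_zero hloc (fun g hg hgs hgΩ => by
    have hz : ∀ x, x ∉ Ω → g x = 0 := fun x hx =>
      image_eq_zero_of_notMem_tsupport fun h => hx (hgΩ h)
    have hi : ∀ {c : Vec → ℝ}, LocallyIntegrableOn c Ω → IntegrableOn (fun x => c x * g x) Ω := by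
      intro c hc
      have h1 : IntegrableOn (fun x => c x * g x) (tsupport g) :=
        (hc.integrableOn_compact_subset hgΩ hgs).mul_continuousOn hg.continuous.continuousOn hgs
      exact h1.of_forall_sdiff_eq_zero hΩ.measurableSet fun x hx => by
        rw [image_eq_zero_of_notMem_tsupport hx.2, mul_zero]
    rw [← setIntegral_eq_integral_of_forall_compl_eq_zero (s := Ω)
      (fun x hx => by simp [hz x hx])]
    have : ∀ x, g x • (a - b) x = a x * g x - b x * g x := fun x => by
      simp only [Pi.sub_apply, smul_eq_mul]; ring
    simp_rw [this]
    rw [integral_sub (hi ha.locallyIntegrable_deriv) (hi hb.locallyIntegrable_deriv),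
      key g ⟨hg, hgs, hgΩ⟩, sub_self])
  rw [ae_restrict_iff' hΩ.measurableSet]
  filter_upwards [h0] with x hx hxΩ
  exact sub_eq_zero.1 (hx hxΩ)

/-! ### Tangential derivatives near a boundary point -/

/-- `w` is a scalar function with weak gradient `p` and weak Hessian `H`, both square integrable. -/
structure IsScalarH2 (Ω : Set Vec) (w : Vec → ℝ) (p : Fin 3 → Vec → ℝ)
    (H : Fin 3 → Fin 3 → Vec → ℝ) : Prop where
  grad : ∀ i, HasWeakPDeriv Ω i w (p i)
  hess : ∀ i j, HasWeakPDeriv Ω j (p i) (H i j)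
  memLp_grad : ∀ i, MemLp (p i) 2 (volume.restrict Ω)
  memLp_hess : ∀ i j, MemLp (H i j) 2 (volume.restrict Ω)

lemma IsScalarH2.symm {Ω : Set Vec} (hΩ : IsOpen Ω) {w : Vec → ℝ} {p : Fin 3 → Vec → ℝ}
    {H : Fin 3 → Fin 3 → Vec → ℝ} (h : IsScalarH2 Ω w p H) (i j : Fin 3) :
    ∀ᵐ x ∂(volume.restrict Ω), H i j x = H j i x :=
  weakHessian_symm hΩ (h.grad i) (h.grad j) (h.hess i j) (h.hess j i)

/-- In the ball of radius `r` around `x₀`, the set `Ω` is `{ρ > 0}`, where `ρ` has slope one in the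
unit direction `E`. -/
structure IsChart (Ω : Set Vec) (x₀ : Vec) (r : ℝ) (ρ : Vec → ℝ) (E : Vec) : Prop where
  pos : 0 < r
  contDiff : ContDiff ℝ 3 ρ
  norm_dir : ‖E‖ = 1
  shift : ∀ x (t : ℝ), ρ (x + t • E) = ρ x + t
  mem_iff : ∀ x ∈ Metric.ball x₀ r, x ∈ Ω ↔ 0 < ρ x

/-- A compactly supported vector field in the ball of radius `r` around `x₀`, tangential to all
level sets of `ρ`. -/
structure IsTangential (x₀ : Vec) (r : ℝ) (ρ : Vec → ℝ) (n : ℕ∞ω)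
    (τ : Fin 3 → Vec → ℝ) : Prop where
  contDiff : ∀ i, ContDiff ℝ n (τ i)
  hasCompactSupport : ∀ i, HasCompactSupport (τ i)
  tsupport_subset : ∀ i, tsupport (τ i) ⊆ Metric.ball x₀ r
  tangent : ∀ x, ∑ i, τ i x * pderiv i ρ x = 0

lemma integrableOn_mul_of_hasCompactSupport {Ω : Set Vec} {f c : Vec → ℝ}
    (hf : MemLp f 2 (volume.restrict Ω)) (hc : Continuous c) (hs : HasCompactSupport c) :
    IntegrableOn (fun x => f x * c x) Ω :=
  hf.integrable_mul ((memLp_of_hasCompactSupport hc hs).restrict Ω)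

lemma pderiv_comp {s : ℝ → ℝ} {ρ : Vec → ℝ} (hs : Differentiable ℝ s) (hρ : Differentiable ℝ ρ)
    (i : Fin 3) (x : Vec) : pderiv i (fun y => s (ρ y)) x = deriv s (ρ x) * pderiv i ρ x := by
  unfold pderiv
  have h := (hs (ρ x)).hasDerivAt.comp_hasFDerivAt x (hρ x).hasFDerivAt
  have h2 : fderiv ℝ (fun y => s (ρ y)) x = _ := h.fderiv
  rw [h2]; simp

/-- The divergence theorem `∫_Ω div (a τ) = 0` for a tangential field `τ`. Since `τ` is tangential
to all level sets of `ρ`, multiplication with a cutoff function of `ρ` produces no error term. -/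
lemma integral_mul_tangential {Ω : Set Vec} (hΩ : IsOpen Ω) {x₀ : Vec} {r : ℝ} {ρ : Vec → ℝ}
    {E : Vec} (hc : IsChart Ω x₀ r ρ E) {τ : Fin 3 → Vec → ℝ} (hτ : IsTangential x₀ r ρ 1 τ)
    {a : Vec → ℝ} {a' : Fin 3 → Vec → ℝ} (ha : ∀ i, HasWeakPDeriv Ω i a (a' i))
    (hal : MemLp a 2 (volume.restrict Ω)) (hal' : ∀ i, MemLp (a' i) 2 (volume.restrict Ω)) :
    ∫ x in Ω, ∑ i, a' i x * τ i x = - ∫ x in Ω, ∑ i, a x * pderiv i (τ i) x := by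
  have hρ1 : ContDiff ℝ 1 ρ := hc.contDiff.of_le (by norm_num)
  let s : ℕ → ℝ → ℝ := fun n y => Real.smoothTransition ((n + 1) * y - 1)
  have hs : ∀ n, ContDiff ℝ 1 (s n) := fun n =>
    Real.smoothTransition.contDiff.comp (by fun_prop)
  have hsρ : ∀ n, ContDiff ℝ 1 (fun x => s n (ρ x)) := fun n => (hs n).comp hρ1
  have hts : ∀ n i, tsupport (fun x => s n (ρ x) * τ i x) ⊆ tsupport (τ i) := fun n i =>
    closure_mono fun x hx => right_ne_zero_of_mul hx
  have hsub : ∀ n i, tsupport (fun x => s n (ρ x) * τ i x) ⊆ Ω := by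
    intro n i x hx
    have h1 : x ∈ Metric.ball x₀ r := hτ.tsupport_subset i (hts n i hx)
    refine (hc.mem_iff x h1).2 ?_
    have h2 : tsupport (fun x => s n (ρ x) * τ i x) ⊆ {x | 1 ≤ (n + 1) * ρ x} := by
      refine closure_minimal (fun y hy => ?_) (isClosed_le continuous_const
        (continuous_const.mul hρ1.continuous))
      by_contra hlt
      simp only [mem_ofPred_eq, not_le] at hlt
      refine left_ne_zero_of_mul hy (Real.smoothTransition.zero_of_nonpos ?_)
      linarith
    have h3 : (1 : ℝ) ≤ (n + 1) * ρ x := h2 hx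
    have h4 : (0 : ℝ) < n + 1 := by positivity
    by_contra hneg
    nlinarith
  have hid : ∀ n, ∫ x in Ω, s n (ρ x) * ∑ i, a' i x * τ i x =
      - ∫ x in Ω, s n (ρ x) * ∑ i, a x * pderiv i (τ i) x := by
    intro n
    have hθ : ∀ i, ContDiff ℝ 1 (fun x => s n (ρ x) * τ i x) := fun i => (hsρ n).mul (hτ.contDiff i)
    have hθs : ∀ i, HasCompactSupport (fun x => s n (ρ x) * τ i x) := fun i =>
      (hτ.hasCompactSupport i).mul_left
    have h1 : ∀ i, ∫ x in Ω, a x * pderiv i (fun x => s n (ρ x) * τ i x) x =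
        - ∫ x in Ω, a' i x * (s n (ρ x) * τ i x) := fun i =>
      (ha i).integral_eq_of_contDiff_one hΩ hal (hal' i) (hθ i) (hθs i) (hsub n i)
    calc ∫ x in Ω, s n (ρ x) * ∑ i, a' i x * τ i x
        = ∫ x in Ω, ∑ i, a' i x * (s n (ρ x) * τ i x) := by
          congr 1; ext x; rw [Finset.mul_sum]; congr 1; ext i; ring
      _ = ∑ i, ∫ x in Ω, a' i x * (s n (ρ x) * τ i x) := by
          rw [integral_finsetSum _ fun i _ =>
            integrableOn_mul_of_hasCompactSupport (hal' i) (hθ i).continuous (hθs i)]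
      _ = - ∑ i, ∫ x in Ω, a x * pderiv i (fun x => s n (ρ x) * τ i x) x := by
          simp_rw [h1, Finset.sum_neg_distrib, neg_neg]
      _ = - ∫ x in Ω, ∑ i, a x * pderiv i (fun x => s n (ρ x) * τ i x) x := by
          rw [integral_finsetSum _ fun i _ => integrableOn_mul_of_hasCompactSupport hal
            (continuous_pderiv (hθ i) i) (hasCompactSupport_pderiv (hθs i) i)]
      _ = _ := by
          congr 2; ext x
          have h2 : ∀ i, a x * pderiv i (fun x => s n (ρ x) * τ i x) x =
              a x * deriv (s n) (ρ x) * (τ i x * pderiv i ρ x) +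
                s n (ρ x) * (a x * pderiv i (τ i) x) := fun i => by
            rw [pderiv_mul (hsρ n) (hτ.contDiff i), pderiv_comp ((hs n).differentiable one_ne_zero)
              (hρ1.differentiable one_ne_zero)]
            ring
          simp_rw [h2, Finset.sum_add_distrib, ← Finset.mul_sum, hτ.tangent, mul_zero, zero_add]
  have hlim : ∀ F : Vec → ℝ, IntegrableOn F Ω → (∀ x ∉ Metric.ball x₀ r, F x = 0) →
      Tendsto (fun n => ∫ x in Ω, s n (ρ x) * F x) atTop (𝓝 (∫ x in Ω, F x)) := by
    intro F hF hF0
    refine tendsto_integral_of_dominated_convergence (fun x => ‖F x‖)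
      (fun n => (hsρ n).continuous.aestronglyMeasurable.mul hF.1) hF.norm
      (fun n => ae_of_all _ fun x => ?_) ?_
    · rw [norm_mul, Real.norm_of_nonneg (Real.smoothTransition.nonneg _)]
      exact mul_le_of_le_one_left (norm_nonneg _) (Real.smoothTransition.le_one _)
    · refine (ae_restrict_iff' hΩ.measurableSet).2 (ae_of_all _ fun x hx => ?_)
      by_cases hb : x ∈ Metric.ball x₀ r
      · have hpos : 0 < ρ x := (hc.mem_iff x hb).1 hx
        obtain ⟨N, hN⟩ := exists_nat_gt (2 / ρ x)
        refine tendsto_const_nhds.congr' ?_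
        filter_upwards [eventually_ge_atTop N] with n hn
        have h1 : s n (ρ x) = 1 := by
          refine Real.smoothTransition.one_of_one_le ?_
          rw [div_lt_iff₀ hpos] at hN
          have : (N : ℝ) ≤ n := by exact_mod_cast hn
          nlinarith
        rw [h1, one_mul]
      · simp [hF0 x hb]
  have hnot : ∀ i, ∀ x ∉ Metric.ball x₀ r, x ∉ tsupport (τ i) := fun i x hx h =>
    hx (hτ.tsupport_subset i h)
  have l1 := hlim (fun x => ∑ i, a' i x * τ i x)
    (integrable_finsetSum _ fun i _ => integrableOn_mul_of_hasCompactSupport (hal' i)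
      (hτ.contDiff i).continuous (hτ.hasCompactSupport i))
    (fun x hx => Finset.sum_eq_zero fun i _ => by
      rw [image_eq_zero_of_notMem_tsupport (hnot i x hx), mul_zero])
  have l2 := hlim (fun x => ∑ i, a x * pderiv i (τ i) x)
    (integrable_finsetSum _ fun i _ => integrableOn_mul_of_hasCompactSupport hal
      (continuous_pderiv (hτ.contDiff i) i) (hasCompactSupport_pderiv (hτ.hasCompactSupport i) i))
    (fun x hx => Finset.sum_eq_zero fun i _ => by
      rw [pderiv_eq_zero_of_notMem (hnot i x hx), mul_zero])
  exact tendsto_nhds_unique (l1.congr hid) l2.neg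

/-- The tangential derivative `u = τ · ∇w`. -/
def tangDeriv (τ p : Fin 3 → Vec → ℝ) (x : Vec) : ℝ := ∑ i, τ i x * p i x

/-- The gradient of `u = τ · ∇w`. -/
noncomputable def tangDerivGrad (τ p : Fin 3 → Vec → ℝ) (H : Fin 3 → Fin 3 → Vec → ℝ) (k : Fin 3)
    (x : Vec) : ℝ := ∑ i, (pderiv k (τ i) x * p i x + τ i x * H i k x)

lemma memLp_tangDeriv {Ω : Set Vec} {w : Vec → ℝ} {p : Fin 3 → Vec → ℝ}
    {H : Fin 3 → Fin 3 → Vec → ℝ} (h : IsScalarH2 Ω w p H) {x₀ : Vec} {r : ℝ} {ρ : Vec → ℝ}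
    {τ : Fin 3 → Vec → ℝ} (hτ : IsTangential x₀ r ρ 2 τ) :
    MemLp (tangDeriv τ p) 2 (volume.restrict Ω) :=
  memLp_finsetSum _ fun i _ =>
    (h.memLp_grad i).mul_hasCompactSupport (hτ.contDiff i).continuous (hτ.hasCompactSupport i)

lemma memLp_tangDerivGrad {Ω : Set Vec} {w : Vec → ℝ} {p : Fin 3 → Vec → ℝ}
    {H : Fin 3 → Fin 3 → Vec → ℝ} (h : IsScalarH2 Ω w p H) {x₀ : Vec} {r : ℝ} {ρ : Vec → ℝ}
    {τ : Fin 3 → Vec → ℝ} (hτ : IsTangential x₀ r ρ 2 τ) (k : Fin 3) :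
    MemLp (tangDerivGrad τ p H k) 2 (volume.restrict Ω) :=
  memLp_finsetSum _ fun i _ =>
    ((h.memLp_grad i).mul_hasCompactSupport
      (continuous_pderiv ((hτ.contDiff i).of_le (by norm_num)) k)
      (hasCompactSupport_pderiv (hτ.hasCompactSupport i) k)).add
    ((h.memLp_hess i k).mul_hasCompactSupport (hτ.contDiff i).continuous (hτ.hasCompactSupport i))

/-- The weak form of `∇w × n = 0` on `∂Ω`, for a gradient `p = ∇w`: the integrations by parts that
exchange `i` and `k` have no boundary term. -/
def HasZeroTangentialTrace (Ω : Set Vec) (p : Fin 3 → Vec → ℝ) : Prop :=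
  ∀ g : Vec → ℝ, ContDiff ℝ 2 g → HasCompactSupport g → ∀ i k : Fin 3,
    ∫ x in Ω, p i x * pderiv k g x = ∫ x in Ω, p k x * pderiv i g x

/-- If `w` vanishes on `∂Ω` then so does `τ · ∇w`: its extension by zero is weakly differentiable in
the whole space. -/
lemma integral_tangDeriv_mul_pderiv {Ω : Set Vec} (hΩ : IsOpen Ω) {x₀ : Vec} {r : ℝ} {ρ : Vec → ℝ}
    {E : Vec} (hc : IsChart Ω x₀ r ρ E) {τ : Fin 3 → Vec → ℝ} (hτ : IsTangential x₀ r ρ 2 τ)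
    {w : Vec → ℝ} {p : Fin 3 → Vec → ℝ} {H : Fin 3 → Fin 3 → Vec → ℝ} (h : IsScalarH2 Ω w p H)
    (h0 : HasZeroTangentialTrace Ω p) (k : Fin 3) {φ : Vec → ℝ} (hφ : ContDiff ℝ ∞ φ)
    (hφs : HasCompactSupport φ) :
    ∫ x in Ω, tangDeriv τ p x * pderiv k φ x = - ∫ x in Ω, tangDerivGrad τ p H k x * φ x := by
  have hφ2 : ContDiff ℝ 2 φ := hφ.of_le (by norm_cast)
  have hφ1 : ContDiff ℝ 1 φ := hφ.of_le (by simp)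
  have hτ1 : ∀ i, ContDiff ℝ 1 (τ i) := fun i => (hτ.contDiff i).of_le (by norm_num)
  let σ : Fin 3 → Vec → ℝ := fun i x => φ x * τ i x
  have hσ2 : ∀ i, ContDiff ℝ 2 (σ i) := fun i => hφ2.mul (hτ.contDiff i)
  have hσ1 : ∀ i, ContDiff ℝ 1 (σ i) := fun i => hφ1.mul (hτ1 i)
  have hσs : ∀ i, HasCompactSupport (σ i) := fun i => hφs.mul_right
  -- `φ τ` is tangential again, so the divergence theorem applies to `∂_k w φ τ`
  have hσ : IsTangential x₀ r ρ 1 σ := by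
    refine ⟨hσ1, hσs, fun i => ?_, fun x => ?_⟩
    · exact (closure_mono fun x hx => right_ne_zero_of_mul hx).trans (hτ.tsupport_subset i)
    · simp_rw [σ, mul_assoc, ← Finset.mul_sum, hτ.tangent, mul_zero]
  have hA := integral_mul_tangential hΩ hc hσ (h.hess k) (h.memLp_grad k) (h.memLp_hess k)
  have hB : ∀ i, ∫ x in Ω, p i x * pderiv k (σ i) x = ∫ x in Ω, p k x * pderiv i (σ i) x :=
    fun i => h0 (σ i) (hσ2 i) (hσs i) i k
  have hBi : ∀ i l m, IntegrableOn (fun x => p l x * pderiv m (σ i) x) Ω := fun i l m =>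
    integrableOn_mul_of_hasCompactSupport (h.memLp_grad l) (continuous_pderiv (hσ1 i) m)
      (hasCompactSupport_pderiv (hσs i) m)
  have hI1 : IntegrableOn (fun x => ∑ i, p i x * pderiv k (σ i) x) Ω :=
    integrable_finsetSum _ fun i _ => hBi i i k
  have hI2 : IntegrableOn (fun x => ∑ i, H k i x * σ i x) Ω :=
    integrable_finsetSum _ fun i _ => integrableOn_mul_of_hasCompactSupport (h.memLp_hess k i)
      (hσ1 i).continuous (hσs i)
  have hsum : ∫ x in Ω, ∑ i, p i x * pderiv k (σ i) x = ∫ x in Ω, ∑ i, p k x * pderiv i (σ i) x := by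
    rw [integral_finsetSum _ fun i _ => hBi i i k, integral_finsetSum _ fun i _ => hBi i k i]
    exact Finset.sum_congr rfl fun i _ => hB i
  have hu1 : IntegrableOn (fun x => tangDeriv τ p x * pderiv k φ x) Ω :=
    integrableOn_mul_of_hasCompactSupport (memLp_tangDeriv h hτ) (continuous_pderiv hφ1 k)
      (hasCompactSupport_pderiv hφs k)
  have hu2 : IntegrableOn (fun x => tangDerivGrad τ p H k x * φ x) Ω :=
    integrableOn_mul_of_hasCompactSupport (memLp_tangDerivGrad h hτ k) hφ.continuous hφs
  have hsymm : ∀ᵐ x ∂(volume.restrict Ω), ∀ i, H i k x = H k i x :=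
    ae_all_iff.2 fun i => h.symm hΩ i k
  have hpt : ∫ x in Ω, (tangDeriv τ p x * pderiv k φ x + tangDerivGrad τ p H k x * φ x) =
      ∫ x in Ω, (∑ i, p i x * pderiv k (σ i) x + ∑ i, H k i x * σ i x) := by
    refine integral_congr_ae ?_
    filter_upwards [hsymm] with x hx
    simp only [tangDeriv, tangDerivGrad, σ, Finset.sum_mul, ← Finset.sum_add_distrib]
    refine Finset.sum_congr rfl fun i _ => ?_
    rw [pderiv_mul hφ1 (hτ1 i), hx]
    ring
  rw [integral_add hu1 hu2, integral_add hI1 hI2, hA, hsum] at hpt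
  linarith

/-- Near the boundary, small translations in the direction `E` move `closure Ω` into `Ω`. -/
lemma IsChart.exists_shift {Ω : Set Vec} {x₀ : Vec} {r : ℝ} {ρ : Vec → ℝ} {E : Vec}
    (hc : IsChart Ω x₀ r ρ E) {K : Set Vec} (hK : IsCompact K) (hKb : K ⊆ Metric.ball x₀ r)
    (hKΩ : K ⊆ closure Ω) :
    ∃ (c : ℕ → Vec) (s : ℕ → ℝ), Tendsto c atTop (𝓝 0) ∧ (∀ n, 0 < s n) ∧
      Tendsto s atTop (𝓝 0) ∧ ∀ n, K + Metric.closedBall (c n) (s n) ⊆ Ω := by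
  obtain ⟨δ, hδ, hδb⟩ := hK.exists_cthickening_subset_open Metric.isOpen_ball hKb
  have hρ1 : ContDiff ℝ 1 ρ := hc.contDiff.of_le (by norm_num)
  -- `ρ` grows by `t` along `t • E`, and loses less than that on a ball of radius `t / (L + 1)`
  obtain ⟨L, hL⟩ := hρ1.contDiffOn.exists_lipschitzOnWith one_ne_zero (convex_closedBall x₀ r)
    (isCompact_closedBall x₀ r)
  have hpos : ∀ x ∈ K, 0 ≤ ρ x := by
    intro x hx
    by_contra hneg
    push Not at hneg
    have hopen : IsOpen (Metric.ball x₀ r ∩ {y | ρ y < 0}) :=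
      Metric.isOpen_ball.inter (isOpen_lt hρ1.continuous continuous_const)
    obtain ⟨y, ⟨hy1, hy2⟩, hyΩ⟩ := mem_closure_iff.1 (hKΩ hx) _ hopen ⟨hKb hx, hneg⟩
    exact lt_asymm ((hc.mem_iff y hy1).1 hyΩ) hy2
  let t : ℕ → ℝ := fun n => δ / 2 / (n + 1)
  have ht : ∀ n, 0 < t n := fun n => by positivity
  have htδ : ∀ n, t n ≤ δ / 2 := fun n =>
    div_le_self (by positivity) (by linarith [(Nat.cast_nonneg n : (0 : ℝ) ≤ n)])
  have htl : Tendsto t atTop (𝓝 0) :=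
    ((tendsto_const_div_atTop_nhds_zero_nat (δ / 2)).comp (tendsto_add_atTop_nat 1)).congr
      fun n => by simp [t]
  refine ⟨fun n => t n • E, fun n => t n / (L + 1), ?_, fun n => by have := ht n; positivity, ?_,
    fun n => ?_⟩
  · simpa using htl.smul_const E
  · simpa using htl.div_const ((L : ℝ) + 1)
  rintro z ⟨x, hx, y, hy, rfl⟩
  have hs1 : t n / (L + 1) ≤ t n := div_le_self (ht n).le (by simp)
  have hL0 : (L : ℝ) * (t n / (L + 1)) < t n := by
    rw [mul_div_assoc', div_lt_iff₀ (by positivity)]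
    nlinarith [ht n]
  set v := y - t n • E with hv
  have hvn : ‖v‖ ≤ t n / (L + 1) := by simpa [dist_eq_norm] using hy
  have hyv : y = v + t n • E := by simp [hv]
  have hyn : ‖y‖ ≤ δ := by
    have h1 := norm_add_le v (t n • E)
    rw [norm_smul, hc.norm_dir, mul_one, Real.norm_of_nonneg (ht n).le] at h1
    rw [hyv]
    linarith [htδ n]
  have hmem : ∀ u : Vec, ‖u‖ ≤ δ → x + u ∈ Metric.ball x₀ r := fun u hu =>
    hδb (Metric.mem_cthickening_of_dist_le _ x _ _ hx (by simpa [dist_eq_norm] using hu))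
  refine (hc.mem_iff _ (hmem y hyn)).2 ?_
  have h1 : ρ (x + y) = ρ (x + v) + t n := by rw [hyv, ← add_assoc, hc.shift]
  have h2 := hL.dist_le_mul (x + v)
    (Metric.ball_subset_closedBall (hmem v (by linarith [htδ n]))) x
    (Metric.ball_subset_closedBall (hKb hx))
  rw [dist_eq_norm, dist_eq_norm, add_sub_cancel_left, Real.norm_eq_abs] at h2
  have h3 := (abs_le.1 h2).1
  have h4 : (L : ℝ) * ‖v‖ ≤ L * (t n / (L + 1)) := by gcongr
  have := hpos x hx
  linarith

/-- Both sides equal `-∫ τ p j ∂_i ∂_j φ`. The Hessian entry `H i j` on the left is exchanged for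
the diagonal entry `H j j` on the right, which contributes to the Laplacian. -/
lemma integral_hess_mul_pderiv {Ω : Set Vec} (hΩ : IsOpen Ω)
    {τ : Vec → ℝ} (hτ : ContDiff ℝ 2 τ)
    {w : Vec → ℝ} {p : Fin 3 → Vec → ℝ} {H : Fin 3 → Fin 3 → Vec → ℝ} (h : IsScalarH2 Ω w p H)
    {φ : Vec → ℝ} (hφ : IsTestFunction Ω φ) (i j : Fin 3) :
    ∫ x in Ω, (τ x * H i j x + pderiv i τ x * p j x) * pderiv j φ x =
      ∫ x in Ω, (pderiv j τ x * p j x + H j j x * τ x) * pderiv i φ x := by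
  have hφ2 : ContDiff ℝ 2 φ := hφ.smooth.of_le (by norm_cast)
  have hτ1 : ContDiff ℝ 1 τ := hτ.of_le (by norm_num)
  have hφ1 : ∀ k, ContDiff ℝ 1 (pderiv k φ) := fun k => contDiff_pderiv hφ2 (by norm_num) k
  have hφs : ∀ k, HasCompactSupport (pderiv k φ) :=
    fun k => hasCompactSupport_pderiv hφ.hasCompactSupport k
  have hθ : ∀ k, ContDiff ℝ 1 (fun x => τ x * pderiv k φ x) := fun k => hτ1.mul (hφ1 k)
  have hθs : ∀ k, HasCompactSupport (fun x => τ x * pderiv k φ x) := fun k => (hφs k).mul_left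
  have hθt : ∀ k, tsupport (fun x => τ x * pderiv k φ x) ⊆ Ω := fun k =>
    (closure_mono fun x hx => right_ne_zero_of_mul hx).trans
      ((tsupport_pderiv_subset φ k).trans hφ.tsupport_subset)
  have ha := (h.hess j i).integral_eq_of_contDiff_one hΩ (h.memLp_grad j) (h.memLp_hess j i)
    (hθ j) (hθs j) (hθt j)
  have hb := (h.hess j j).integral_eq_of_contDiff_one hΩ (h.memLp_grad j) (h.memLp_hess j j)
    (hθ i) (hθs i) (hθt i)
  have hint : ∀ {f : Vec → ℝ} {c : Vec → ℝ}, MemLp f 2 (volume.restrict Ω) → Continuous c →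
      HasCompactSupport c → IntegrableOn (fun x => f x * c x) Ω :=
    fun hf hc hs => integrableOn_mul_of_hasCompactSupport hf hc hs
  have i1 := hint (h.memLp_hess j i) (hθ j).continuous (hθs j)
  have i2 := hint (h.memLp_hess j j) (hθ i).continuous (hθs i)
  have i3 := hint (h.memLp_grad j) (continuous_pderiv (hθ j) i) (hasCompactSupport_pderiv (hθs j) i)
  have i4 := hint (h.memLp_grad j) (continuous_pderiv (hθ i) j) (hasCompactSupport_pderiv (hθs i) j)
  have e1 : ∫ x in Ω, (τ x * H i j x + pderiv i τ x * p j x) * pderiv j φ x -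
      (pderiv j τ x * p j x + H j j x * τ x) * pderiv i φ x =
      ∫ x in Ω, (H j i x * (τ x * pderiv j φ x) - H j j x * (τ x * pderiv i φ x)) +
        (p j x * pderiv i (fun x => τ x * pderiv j φ x) x -
          p j x * pderiv j (fun x => τ x * pderiv i φ x) x) := by
    refine integral_congr_ae ?_
    filter_upwards [h.symm hΩ i j] with x hx
    rw [pderiv_mul hτ1 (hφ1 j), pderiv_mul hτ1 (hφ1 i), pderiv_comm hφ2 i j, hx]
    ring
  have e2 := integral_add (i1.sub i2) (i3.sub i4)
  simp only [Pi.sub_apply] at e2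
  rw [e2, integral_sub i1 i2, integral_sub i3 i4, ha, hb] at e1
  have j1 : IntegrableOn (fun x => (τ x * H i j x + pderiv i τ x * p j x) * pderiv j φ x) Ω := by
    have a1 := hint (h.memLp_hess i j) (hθ j).continuous (hθs j)
    have a2 := hint (h.memLp_grad j) ((continuous_pderiv hτ1 i).mul (hφ1 j).continuous)
      (hφs j).mul_left
    exact (a1.add a2).congr (ae_of_all _ fun x => by simp only [Pi.add_apply, Pi.mul_apply]; ring)
  have j2 : IntegrableOn (fun x => (pderiv j τ x * p j x + H j j x * τ x) * pderiv i φ x) Ω := by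
    have a1 := hint (h.memLp_hess j j) (hθ i).continuous (hθs i)
    have a2 := hint (h.memLp_grad j) ((continuous_pderiv hτ1 j).mul (hφ1 i).continuous)
      (hφs i).mul_left
    exact (a1.add a2).congr (ae_of_all _ fun x => by simp only [Pi.add_apply, Pi.mul_apply]; ring)
  rw [integral_sub j1 j2] at e1
  linarith

/-- The identity of `integral_hess_mul_pderiv` with `u = τ · ∇w` as test function. It is a limit of
test functions in `Ω` because its extension by zero is in `H¹(ℝ³)` and its support can be shifted
into `Ω`. -/
lemma integral_hess_mul_tangDerivGrad {Ω : Set Vec} (hΩ : IsOpen Ω) {x₀ : Vec} {r : ℝ}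
    {ρ : Vec → ℝ} {E : Vec} (hc : IsChart Ω x₀ r ρ E) {τ : Fin 3 → Vec → ℝ}
    (hτ : IsTangential x₀ r ρ 2 τ) {w : Vec → ℝ} {p : Fin 3 → Vec → ℝ}
    {H : Fin 3 → Fin 3 → Vec → ℝ} (h : IsScalarH2 Ω w p H) (h0 : HasZeroTangentialTrace Ω p)
    (i j : Fin 3) :
    ∫ x in Ω, (τ i x * H i j x + pderiv i (τ i) x * p j x) * tangDerivGrad τ p H j x =
      ∫ x in Ω, (pderiv j (τ i) x * p j x + H j j x * τ i x) * tangDerivGrad τ p H i x := by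
  have hm := hΩ.measurableSet
  set K : Set Vec := closure Ω ∩ ⋃ i, tsupport (τ i) with hKdef
  have hK : IsCompact K := by
    refine IsCompact.inter_left ?_ isClosed_closure
    exact isCompact_iUnion fun i => hτ.hasCompactSupport i
  obtain ⟨c, s, hc0, hs, hs0, hsub⟩ := hc.exists_shift hK
    (fun x hx => by
      obtain ⟨i, hi⟩ := mem_iUnion.1 hx.2
      exact hτ.tsupport_subset i hi) (fun x hx => hx.1)
  have hτ1 : ContDiff ℝ 1 (τ i) := (hτ.contDiff i).of_le (by norm_num)
  obtain ⟨φ, hφ, hlim⟩ := exists_isTestFunction_tendsto hK hc0 hs hs0 hsub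
    (U := Ω.indicator (tangDeriv τ p)) (V := fun k => Ω.indicator (tangDerivGrad τ p H k))
    (memLp_indicator hm (memLp_tangDeriv h hτ))
    (fun k => memLp_indicator hm (memLp_tangDerivGrad h hτ k))
    (fun k φ hφ hφs => by
      rw [integral_indicator_mul hm, integral_indicator_mul hm]
      exact integral_tangDeriv_mul_pderiv hΩ hc hτ h h0 k hφ hφs)
    (fun x hx => by
      by_cases hxΩ : x ∈ Ω
      · rw [indicator_of_mem hxΩ]
        refine Finset.sum_eq_zero fun i _ => ?_
        rw [image_eq_zero_of_notMem_tsupport fun hi => hx ⟨subset_closure hxΩ, mem_iUnion.2 ⟨i, hi⟩⟩,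
          zero_mul]
      · exact indicator_of_notMem hxΩ _)
  have hcτ := (hτ.contDiff i).continuous
  have hsτ := hτ.hasCompactSupport i
  have mA : MemLp (fun x => τ i x * H i j x + pderiv i (τ i) x * p j x) 2 (volume.restrict Ω) :=
    ((h.memLp_hess i j).mul_hasCompactSupport hcτ hsτ).add
      ((h.memLp_grad j).mul_hasCompactSupport (continuous_pderiv hτ1 i)
        (hasCompactSupport_pderiv hsτ i))
  have mB : MemLp (fun x => pderiv j (τ i) x * p j x + H j j x * τ i x) 2 (volume.restrict Ω) := by
    have := ((h.memLp_grad j).mul_hasCompactSupport (continuous_pderiv hτ1 j)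
        (hasCompactSupport_pderiv hsτ j)).add ((h.memLp_hess j j).mul_hasCompactSupport hcτ hsτ)
    refine this.ae_eq (ae_of_all _ fun x => ?_)
    simp only [Pi.add_apply]; ring
  have lA := (hlim _ (memLp_indicator hm mA)).2 j
  have lB := (hlim _ (memLp_indicator hm mB)).2 i
  simp only [integral_indicator_mul_indicator hm] at lA lB
  simp only [integral_indicator_mul hm] at lA lB
  exact tendsto_nhds_unique
    (lA.congr fun n => integral_hess_mul_pderiv hΩ (hτ.contDiff i) h (hφ n) i j) lB

/-! ### The energy estimate for tangential derivatives -/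

lemma sq_sum_abs_le (p : Fin 3 → ℝ) : (∑ i, |p i|) ^ 2 ≤ 3 * ∑ i, p i ^ 2 := by
  have := sq_sum_le_card_mul_sum_sq (s := Finset.univ) (f := fun i => |p i|)
  simpa using this

lemma abs_sum_mul_le {M : ℝ} {a p : Fin 3 → ℝ} (ha : ∀ i, |a i| ≤ M) :
    |∑ i, a i * p i| ≤ M * ∑ i, |p i| := by
  rw [Finset.mul_sum]
  refine (Finset.abs_sum_le_sum_abs _ _).trans (Finset.sum_le_sum fun i _ => ?_)
  rw [abs_mul]
  exact mul_le_mul_of_nonneg_right (ha i) (abs_nonneg _)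

/-- The right-hand side of the energy identity is controlled by the gradient `p` and the Laplacian
`∑ i, h i`, uniformly in terms of a bound `M` for the vector field and its derivatives. -/
lemma sq_remainder_le {M : ℝ} {t : Fin 3 → ℝ} {dt : Fin 3 → Fin 3 → ℝ} (ht : ∀ i, |t i| ≤ M)
    (hdt : ∀ i j, |dt i j| ≤ M) (p h : Fin 3 → ℝ) (j : Fin 3) :
    (∑ i, ((dt j i * p i + h i * t j) + (dt i j * p i - dt i i * p j))) ^ 2 ≤
      150 * M ^ 2 * (∑ i, p i ^ 2 + (∑ i, h i) ^ 2) := by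
  set P := ∑ i, |p i| with hP
  have hM : 0 ≤ M := (abs_nonneg _).trans (ht 0)
  have e : ∑ i, ((dt j i * p i + h i * t j) + (dt i j * p i - dt i i * p j)) =
      ∑ i, dt j i * p i + (∑ i, h i) * t j + ∑ i, dt i j * p i - (∑ i, dt i i * p j) := by
    rw [Finset.sum_add_distrib, Finset.sum_add_distrib, Finset.sum_sub_distrib, Finset.sum_mul]
    ring
  have h1 : |∑ i, dt j i * p i| ≤ M * P := abs_sum_mul_le fun i => hdt j i
  have h2 : |∑ i, dt i j * p i| ≤ M * P := abs_sum_mul_le fun i => hdt i j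
  have hpj : |p j| ≤ P := Finset.single_le_sum (f := fun i => |p i|) (fun i _ => abs_nonneg _)
    (Finset.mem_univ j)
  have h3 : |∑ i, dt i i * p j| ≤ 3 * (M * P) := by
    have := abs_sum_mul_le (p := fun _ => p j) fun i => hdt i i
    simp only [Finset.sum_const, Finset.card_univ, Fintype.card_fin, nsmul_eq_mul] at this
    refine this.trans ?_
    push_cast
    nlinarith
  have h4 : |(∑ i, h i) * t j| ≤ M * |∑ i, h i| := by
    rw [abs_mul, mul_comm]
    exact mul_le_mul_of_nonneg_right (ht j) (abs_nonneg _)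
  have h5 : |∑ i, ((dt j i * p i + h i * t j) + (dt i j * p i - dt i i * p j))| ≤
      M * (5 * P + |∑ i, h i|) := by
    rw [e]
    have a1 := abs_sub (∑ i, dt j i * p i + (∑ i, h i) * t j + ∑ i, dt i j * p i)
      (∑ i, dt i i * p j)
    have a2 := abs_add_le (∑ i, dt j i * p i + (∑ i, h i) * t j) (∑ i, dt i j * p i)
    have a3 := abs_add_le (∑ i, dt j i * p i) ((∑ i, h i) * t j)
    linarith
  have h6 : P ^ 2 ≤ 3 * ∑ i, p i ^ 2 := sq_sum_abs_le p
  have h7 : (5 * P + |∑ i, h i|) ^ 2 ≤ 150 * (∑ i, p i ^ 2 + (∑ i, h i) ^ 2) := by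
    nlinarith [sq_nonneg (5 * P - |∑ i, h i|), sq_abs (∑ i, h i), sq_nonneg (∑ i, h i)]
  calc _ = |∑ i, ((dt j i * p i + h i * t j) + (dt i j * p i - dt i i * p j))| ^ 2 := (sq_abs _).symm
    _ ≤ (M * (5 * P + |∑ i, h i|)) ^ 2 := pow_le_pow_left₀ (abs_nonneg _) h5 2
    _ = M ^ 2 * (5 * P + |∑ i, h i|) ^ 2 := by ring
    _ ≤ M ^ 2 * (150 * (∑ i, p i ^ 2 + (∑ i, h i) ^ 2)) := by gcongr
    _ = _ := by ring

lemma IsScalarH2.integrableOn_data {Ω : Set Vec} {w : Vec → ℝ} {p : Fin 3 → Vec → ℝ}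
    {H : Fin 3 → Fin 3 → Vec → ℝ} (h : IsScalarH2 Ω w p H) :
    IntegrableOn (fun x => ∑ i, p i x ^ 2 + (∑ i, H i i x) ^ 2) Ω :=
  (integrable_finsetSum _ fun i _ => (h.memLp_grad i).integrable_sq).add
    (memLp_finsetSum _ fun i _ => h.memLp_hess i i).integrable_sq

/-- The energy identity for `u = τ · ∇w`: `∂_j u` is the sum over `i` of `A i j`, which contains
`τ i H i j`, and of the first order terms `D i j`. Tested with `∂_j u`, the terms `A i j` turn into
`B i j` tested with `∂_i u`; the sum of the `B j i` over `i` contains second derivatives only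
through the Laplacian. -/
lemma integral_sq_tangDerivGrad_le {Ω : Set Vec} (hΩ : IsOpen Ω) {x₀ : Vec} {r : ℝ}
    {ρ : Vec → ℝ} {E : Vec} (hc : IsChart Ω x₀ r ρ E) {τ : Fin 3 → Vec → ℝ}
    (hτ : IsTangential x₀ r ρ 2 τ) {M : ℝ} (hM : ∀ i x, |τ i x| ≤ M)
    (hM' : ∀ i j x, |pderiv j (τ i) x| ≤ M) {w : Vec → ℝ} {p : Fin 3 → Vec → ℝ}
    {H : Fin 3 → Fin 3 → Vec → ℝ} (h : IsScalarH2 Ω w p H) (h0 : HasZeroTangentialTrace Ω p) :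
    ∫ x in Ω, ∑ j, tangDerivGrad τ p H j x ^ 2 ≤
      450 * M ^ 2 * ∫ x in Ω, (∑ i, p i x ^ 2 + (∑ i, H i i x) ^ 2) := by
  set u := tangDerivGrad τ p H with hu
  let A : Fin 3 → Fin 3 → Vec → ℝ := fun i j x => τ i x * H i j x + pderiv i (τ i) x * p j x
  let B : Fin 3 → Fin 3 → Vec → ℝ := fun i j x => pderiv j (τ i) x * p j x + H j j x * τ i x
  let D : Fin 3 → Fin 3 → Vec → ℝ := fun i j x => pderiv j (τ i) x * p i x - pderiv i (τ i) x * p j x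
  have hτ1 : ∀ i, ContDiff ℝ 1 (τ i) := fun i => (hτ.contDiff i).of_le (by norm_num)
  have m1 : ∀ i j k, MemLp (fun x => pderiv j (τ i) x * p k x) 2 (volume.restrict Ω) :=
    fun i j k => (h.memLp_grad k).mul_hasCompactSupport (continuous_pderiv (hτ1 i) j)
      (hasCompactSupport_pderiv (hτ.hasCompactSupport i) j)
  have m2 : ∀ i j k, MemLp (fun x => τ i x * H j k x) 2 (volume.restrict Ω) :=
    fun i j k => (h.memLp_hess j k).mul_hasCompactSupport (hτ1 i).continuous (hτ.hasCompactSupport i)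
  have mA : ∀ i j, MemLp (A i j) 2 (volume.restrict Ω) := fun i j => (m2 i i j).add (m1 i i j)
  have mB : ∀ i j, MemLp (B i j) 2 (volume.restrict Ω) := fun i j =>
    ((m1 i j j).add (m2 i j j)).ae_eq (ae_of_all _ fun x => by
      simp only [Pi.add_apply, B]; ring)
  have mD : ∀ i j, MemLp (D i j) 2 (volume.restrict Ω) := fun i j => (m1 i j i).sub (m1 i i j)
  have mu : ∀ j, MemLp (u j) 2 (volume.restrict Ω) := fun j => memLp_tangDerivGrad h hτ j
  have iA : ∀ i j k, IntegrableOn (fun x => A i j x * u k x) Ω := fun i j k =>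
    (mA i j).integrable_mul (mu k)
  have iB : ∀ i j k, IntegrableOn (fun x => B i j x * u k x) Ω := fun i j k =>
    (mB i j).integrable_mul (mu k)
  have iD : ∀ i j k, IntegrableOn (fun x => D i j x * u k x) Ω := fun i j k =>
    (mD i j).integrable_mul (mu k)
  have iAD : ∀ i j, IntegrableOn (fun x => A i j x * u j x + D i j x * u j x) Ω := fun i j =>
    (iA i j j).add (iD i j j)
  have iBD' : ∀ i j, IntegrableOn (fun x => B j i x * u j x + D i j x * u j x) Ω := fun i j =>
    (iB j i j).add (iD i j j)
  have energy : ∫ x in Ω, ∑ j, u j x ^ 2 = ∫ x in Ω, ∑ j, ∑ i, (B j i x * u j x + D i j x * u j x) := by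
    calc ∫ x in Ω, ∑ j, u j x ^ 2 = ∫ x in Ω, ∑ j, ∑ i, (A i j x * u j x + D i j x * u j x) := by
          congr 1; ext x
          refine Finset.sum_congr rfl fun j _ => ?_
          simp_rw [← add_mul]
          rw [← Finset.sum_mul, sq]
          congr 1
          simp only [hu, tangDerivGrad, A, D]
          exact Finset.sum_congr rfl fun i _ => by ring
      _ = ∑ j, ∑ i, ((∫ x in Ω, A i j x * u j x) + ∫ x in Ω, D i j x * u j x) := by
          rw [integral_finsetSum _ fun j _ => integrable_finsetSum _ fun i _ => iAD i j]
          refine Finset.sum_congr rfl fun j _ => ?_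
          rw [integral_finsetSum _ fun i _ => iAD i j]
          exact Finset.sum_congr rfl fun i _ => integral_add (iA i j j) (iD i j j)
      _ = ∑ j, ∑ i, ((∫ x in Ω, B j i x * u j x) + ∫ x in Ω, D i j x * u j x) := by
          simp_rw [Finset.sum_add_distrib]
          congr 1
          rw [Finset.sum_comm]
          exact Finset.sum_congr rfl fun i _ => Finset.sum_congr rfl fun j _ =>
            integral_hess_mul_tangDerivGrad hΩ hc hτ h h0 i j
      _ = _ := by
          rw [integral_finsetSum _ fun j _ => integrable_finsetSum _ fun i _ => iBD' i j]
          refine Finset.sum_congr rfl fun j _ => ?_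
          rw [integral_finsetSum _ fun i _ => iBD' i j]
          exact Finset.sum_congr rfl fun i _ => (integral_add (iB j i j) (iD i j j)).symm
  have iu : IntegrableOn (fun x => ∑ j, u j x ^ 2) Ω :=
    integrable_finsetSum _ fun j _ => (mu j).integrable_sq
  have iBD : IntegrableOn (fun x => ∑ j, ∑ i, (B j i x * u j x + D i j x * u j x)) Ω :=
    integrable_finsetSum _ fun j _ => integrable_finsetSum _ fun i _ => iBD' i j
  have hle : ∫ x in Ω, ∑ j, ∑ i, (B j i x * u j x + D i j x * u j x) ≤
      ∫ x in Ω, ((1 / 2) * ∑ j, u j x ^ 2 +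
        (225 * M ^ 2) * (∑ i, p i x ^ 2 + (∑ i, H i i x) ^ 2)) := by
    refine integral_mono iBD ((iu.const_mul _).add (h.integrableOn_data.const_mul _)) fun x => ?_
    have hj : ∀ j, ∑ i, (B j i x * u j x + D i j x * u j x) ≤ (1 / 2) * u j x ^ 2 +
        (75 * M ^ 2) * (∑ i, p i x ^ 2 + (∑ i, H i i x) ^ 2) := by
      intro j
      have hR := sq_remainder_le (fun i => hM i x) (fun i j => hM' i j x) (fun i => p i x)
        (fun i => H i i x) j
      simp_rw [← add_mul]
      rw [← Finset.sum_mul]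
      simp only [B, D]
      set R := ∑ i, ((pderiv i (τ j) x * p i x + H i i x * τ j x) +
        (pderiv j (τ i) x * p i x - pderiv i (τ i) x * p j x))
      nlinarith [sq_nonneg (R - u j x)]
    refine (Finset.sum_le_sum fun j _ => hj j).trans (le_of_eq ?_)
    rw [Finset.sum_add_distrib, ← Finset.mul_sum, Finset.sum_const, Finset.card_univ,
      Fintype.card_fin, nsmul_eq_mul]
    push_cast; ring
  rw [integral_add (iu.const_mul _) (h.integrableOn_data.const_mul _), integral_const_mul,
    integral_const_mul, ← energy] at hle
  linarith

/-- All second derivatives with one tangential direction are controlled by the gradient and the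
Laplacian. -/
lemma integral_sq_tangential_hess_le {Ω : Set Vec} (hΩ : IsOpen Ω) {x₀ : Vec} {r : ℝ}
    {ρ : Vec → ℝ} {E : Vec} (hc : IsChart Ω x₀ r ρ E) {τ : Fin 3 → Vec → ℝ}
    (hτ : IsTangential x₀ r ρ 2 τ) {M : ℝ} (hM : ∀ i x, |τ i x| ≤ M)
    (hM' : ∀ i j x, |pderiv j (τ i) x| ≤ M) {w : Vec → ℝ} {p : Fin 3 → Vec → ℝ}
    {H : Fin 3 → Fin 3 → Vec → ℝ} (h : IsScalarH2 Ω w p H) (h0 : HasZeroTangentialTrace Ω p) :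
    ∫ x in Ω, ∑ j, (∑ i, τ i x * H i j x) ^ 2 ≤
      1000 * M ^ 2 * ∫ x in Ω, (∑ i, p i x ^ 2 + (∑ i, H i i x) ^ 2) := by
  have hu := integral_sq_tangDerivGrad_le hΩ hc hτ hM hM' h h0
  have iu : IntegrableOn (fun x => ∑ j, tangDerivGrad τ p H j x ^ 2) Ω :=
    integrable_finsetSum _ fun j _ => (memLp_tangDerivGrad h hτ j).integrable_sq
  have ib : IntegrableOn (fun x => ∑ j, (∑ i, τ i x * H i j x) ^ 2) Ω :=
    integrable_finsetSum _ fun j _ => (memLp_finsetSum _ fun i _ =>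
      (h.memLp_hess i j).mul_hasCompactSupport (hτ.contDiff i).continuous
        (hτ.hasCompactSupport i)).integrable_sq
  have hle : ∫ x in Ω, ∑ j, (∑ i, τ i x * H i j x) ^ 2 ≤
      ∫ x in Ω, (2 * ∑ j, tangDerivGrad τ p H j x ^ 2 +
        (18 * M ^ 2) * (∑ i, p i x ^ 2 + (∑ i, H i i x) ^ 2)) := by
    refine integral_mono ib ((iu.const_mul _).add (h.integrableOn_data.const_mul _)) fun x => ?_
    have hj : ∀ j, (∑ i, τ i x * H i j x) ^ 2 ≤ 2 * tangDerivGrad τ p H j x ^ 2 +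
        (6 * M ^ 2) * (∑ i, p i x ^ 2 + (∑ i, H i i x) ^ 2) := by
      intro j
      have e : tangDerivGrad τ p H j x =
          ∑ i, pderiv j (τ i) x * p i x + ∑ i, τ i x * H i j x := Finset.sum_add_distrib
      have h1 : |∑ i, pderiv j (τ i) x * p i x| ≤ M * ∑ i, |p i x| :=
        abs_sum_mul_le fun i => hM' i j x
      have h2 := pow_le_pow_left₀ (abs_nonneg _) h1 2
      rw [sq_abs, mul_pow] at h2
      have h3 := sq_sum_abs_le fun i => p i x
      have h4 : M ^ 2 * (∑ i, |p i x|) ^ 2 ≤ M ^ 2 * (3 * ∑ i, p i x ^ 2) := by gcongr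
      have h5 : 0 ≤ M ^ 2 * (∑ i, H i i x) ^ 2 := by positivity
      rw [e]
      set a := ∑ i, pderiv j (τ i) x * p i x
      set b := ∑ i, τ i x * H i j x
      nlinarith [sq_nonneg (2 * a + b)]
    refine (Finset.sum_le_sum fun j _ => hj j).trans (le_of_eq ?_)
    rw [Finset.sum_add_distrib, ← Finset.mul_sum, Finset.sum_const, Finset.card_univ,
      Fintype.card_fin, nsmul_eq_mul]
    push_cast; ring
  rw [integral_add (iu.const_mul _) (h.integrableOn_data.const_mul _), integral_const_mul,
    integral_const_mul] at hle
  have hI : 0 ≤ ∫ x in Ω, (∑ i, p i x ^ 2 + (∑ i, H i i x) ^ 2) :=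
    integral_nonneg fun x => by positivity
  nlinarith [mul_nonneg (sq_nonneg M) hI]

/-- The Laplacian and the tangential part `b` of the Hessian `H` determine the full Hessian. Here
`q` is the gradient of `ρ`, and `b i` is `H` applied to the tangential vector `e_i - q i E`. -/
lemma sum_sq_hess_le {R : ℝ} (hR : 1 ≤ R) {H b : Fin 3 → Fin 3 → ℝ} {q E : Fin 3 → ℝ}
    (hsymm : ∀ i j, H i j = H j i) (hq : ∀ i, |q i| ≤ R) (hE : ∑ i, E i ^ 2 = 1)
    (hEq : ∑ i, E i * q i = 1) (hb : ∀ i j, b i j = H i j - q i * ∑ k, E k * H k j) :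
    ∑ i, ∑ j, H i j ^ 2 ≤ 6000 * R ^ 6 * ((∑ i, H i i) ^ 2 + ∑ i, ∑ j, b i j ^ 2) := by
  set F := ∑ i, H i i with hF
  set c : Fin 3 → ℝ := fun j => ∑ k, E k * H k j with hc
  set β : Fin 3 → ℝ := fun j => ∑ k, E k * b j k with hβ
  set h := ∑ k, E k * c k with hh
  set B := ∑ i, ∑ j, |b i j| with hB
  have hB0 : 0 ≤ B := by positivity
  have hH : ∀ i j, H i j = b i j + q i * c j := fun i j => by rw [hb]; ring
  -- `H` is `q ⊗ q` times the scalar `h`, up to tangential terms; the trace then determines `h`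
  have hcβ : ∀ j, c j = β j + q j * h := by
    intro j
    have : c j = ∑ k, E k * (b j k + q j * c k) :=
      Finset.sum_congr rfl fun k _ => by rw [hsymm, hH]
    rw [this, hβ, hh, Finset.mul_sum, ← Finset.sum_add_distrib]
    exact Finset.sum_congr rfl fun k _ => by ring
  have hFe : F = ∑ i, b i i + ∑ i, q i * β i + (∑ i, q i ^ 2) * h := by
    rw [hF, Finset.sum_mul, ← Finset.sum_add_distrib, ← Finset.sum_add_distrib]
    exact Finset.sum_congr rfl fun i _ => by rw [hH, hcβ]; ring
  have hq1 : 1 ≤ ∑ i, q i ^ 2 := by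
    have := Finset.sum_mul_sq_le_sq_mul_sq Finset.univ E q
    rwa [hEq, hE, one_pow, one_mul] at this
  have hE1 : ∀ k, |E k| ≤ 1 := fun k => by
    have : E k ^ 2 ≤ ∑ i, E i ^ 2 :=
      Finset.single_le_sum (f := fun i => E i ^ 2) (fun i _ => sq_nonneg _) (Finset.mem_univ k)
    exact (sq_le_one_iff_abs_le_one _).1 (this.trans hE.le)
  have hrow : ∀ j, ∑ k, |b j k| ≤ B := fun j =>
    Finset.single_le_sum (f := fun i => ∑ k, |b i k|)
      (fun i _ => Finset.sum_nonneg fun k _ => abs_nonneg _) (Finset.mem_univ j)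
  have hbB : ∀ i j, |b i j| ≤ B := fun i j =>
    (Finset.single_le_sum (f := fun k => |b i k|) (fun k _ => abs_nonneg _)
      (Finset.mem_univ j)).trans (hrow i)
  have hβB : ∀ j, |β j| ≤ B := fun j =>
    (abs_sum_mul_le hE1).trans (by rw [one_mul]; exact hrow j)
  have htr : |∑ i, b i i| ≤ B :=
    (Finset.abs_sum_le_sum_abs _ _).trans (Finset.sum_le_sum fun i _ =>
      Finset.single_le_sum (f := fun k => |b i k|) (fun k _ => abs_nonneg _) (Finset.mem_univ i))
  have hqβ : |∑ i, q i * β i| ≤ 3 * R * B := by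
    refine (abs_sum_mul_le hq).trans ?_
    have : ∑ i, |β i| ≤ 3 * B := by
      refine (Finset.sum_le_sum fun i _ => hβB i).trans ?_
      simp
    nlinarith
  have hhb : |h| ≤ |F| + B + 3 * R * B := by
    have h1 : (∑ i, q i ^ 2) * h = F - ∑ i, b i i - ∑ i, q i * β i := by rw [hFe]; ring
    have h2 : |h| ≤ |(∑ i, q i ^ 2) * h| := by
      rw [abs_mul, abs_of_nonneg (a := ∑ i, q i ^ 2) (by linarith)]
      exact le_mul_of_one_le_left (abs_nonneg _) hq1
    rw [h1] at h2
    have a1 := abs_sub (F - ∑ i, b i i) (∑ i, q i * β i)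
    have a2 := abs_sub F (∑ i, b i i)
    linarith
  have hR0 : 0 ≤ R := by linarith
  have hHb : ∀ i j, |H i j| ≤ 6 * R ^ 3 * (B + |F|) := by
    intro i j
    rw [hH, hcβ]
    have a1 : |b i j + q i * (β j + q j * h)| ≤ |b i j| + |q i| * (|β j| + |q j| * |h|) := by
      refine (abs_add_le _ _).trans ?_
      rw [abs_mul]
      gcongr
      refine (abs_add_le _ _).trans ?_
      rw [abs_mul]
    have a2 : |b i j| + |q i| * (|β j| + |q j| * |h|) ≤ B + R * (B + R * (|F| + B + 3 * R * B)) := by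
      gcongr
      · exact hbB i j
      · exact hq i
      · exact hβB j
      · exact hq j
    refine a1.trans (a2.trans ?_)
    have r2 : R ≤ R ^ 3 := le_self_pow₀ hR (by norm_num)
    have r3 : R ^ 2 ≤ R ^ 3 := pow_le_pow_right₀ hR (by norm_num)
    have r4 : 1 ≤ R ^ 3 := one_le_pow₀ hR
    nlinarith [abs_nonneg F, mul_le_mul_of_nonneg_right r2 hB0, mul_le_mul_of_nonneg_right r3 hB0,
      mul_le_mul_of_nonneg_right r4 hB0, mul_le_mul_of_nonneg_right r3 (abs_nonneg F),
      mul_nonneg (by positivity : 0 ≤ R ^ 3) (abs_nonneg F)]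
  have hBsq : B ^ 2 ≤ 9 * ∑ i, ∑ j, b i j ^ 2 := by
    have e1 := sq_sum_abs_le fun i => ∑ j, |b i j|
    have e2 : ∑ i, |(∑ j, |b i j|)| = B := Finset.sum_congr rfl fun i _ =>
      abs_of_nonneg (Finset.sum_nonneg fun _ _ => abs_nonneg _)
    simp only [e2] at e1
    have e3 : ∑ i, (∑ j, |b i j|) ^ 2 ≤ ∑ i, 3 * ∑ j, b i j ^ 2 :=
      Finset.sum_le_sum fun i _ => sq_sum_abs_le _
    rw [← Finset.mul_sum] at e3
    linarith
  have hS : 0 ≤ ∑ i, ∑ j, b i j ^ 2 := by positivity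
  have hsq : ∀ i j, H i j ^ 2 ≤ 648 * R ^ 6 * (F ^ 2 + ∑ i, ∑ j, b i j ^ 2) := by
    intro i j
    have h1 := pow_le_pow_left₀ (abs_nonneg _) (hHb i j) 2
    rw [sq_abs] at h1
    have h2 : (B + |F|) ^ 2 ≤ 18 * (F ^ 2 + ∑ i, ∑ j, b i j ^ 2) := by
      nlinarith [sq_nonneg (B - |F|), sq_abs F, sq_nonneg F]
    calc H i j ^ 2 ≤ (6 * R ^ 3 * (B + |F|)) ^ 2 := h1
      _ = 36 * R ^ 6 * (B + |F|) ^ 2 := by ring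
      _ ≤ 36 * R ^ 6 * (18 * (F ^ 2 + ∑ i, ∑ j, b i j ^ 2)) := by gcongr
      _ = _ := by ring
  calc ∑ i, ∑ j, H i j ^ 2 ≤ ∑ i : Fin 3, ∑ j : Fin 3,
        648 * R ^ 6 * (F ^ 2 + ∑ i, ∑ j, b i j ^ 2) :=
        Finset.sum_le_sum fun i _ => Finset.sum_le_sum fun j _ => hsq i j
    _ = 5832 * R ^ 6 * (F ^ 2 + ∑ i, ∑ j, b i j ^ 2) := by
        simp only [Finset.sum_const, Finset.card_univ, Fintype.card_fin, nsmul_eq_mul]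
        push_cast; ring
    _ ≤ _ := by gcongr; norm_num

/-! ### The `H²` estimate up to the boundary -/

lemma exists_bound_of_hasCompactSupport {ι : Type*} [Finite ι] {f : ι → Vec → ℝ}
    (hf : ∀ i, Continuous (f i)) (hs : ∀ i, HasCompactSupport (f i)) :
    ∃ M : ℝ, 0 ≤ M ∧ ∀ i x, |f i x| ≤ M := by
  choose C hC using fun i => (hf i).bounded_above_of_compact_support (hs i)
  obtain ⟨M, hM⟩ := (Set.finite_range C).bddAbove
  exact ⟨max M 0, le_max_right _ _, fun i x =>
    ((hC i x).trans (hM (mem_range_self i))).trans (le_max_left _ _)⟩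

lemma sum_mul_pderiv (E : Vec) (ρ : Vec → ℝ) (x : Vec) :
    ∑ i, E i * pderiv i ρ x = fderiv ℝ ρ x E := by
  have hE : E = ∑ i, E i • EuclideanSpace.single i (1 : ℝ) := by
    ext j
    simp [Finset.sum_apply, Pi.single_apply]
  conv_rhs => rw [hE]
  rw [map_sum]
  simp [pderiv]

lemma IsChart.sum_mul_pderiv_eq_one {Ω : Set Vec} {x₀ : Vec} {r : ℝ} {ρ : Vec → ℝ} {E : Vec}
    (hc : IsChart Ω x₀ r ρ E) (x : Vec) : ∑ i, E i * pderiv i ρ x = 1 := by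
  rw [sum_mul_pderiv]
  have hρ1 : ContDiff ℝ 1 ρ := hc.contDiff.of_le (by norm_num)
  have hl : HasDerivAt (fun t : ℝ => x + t • E) E 0 := by
    simpa using ((hasDerivAt_id (0 : ℝ)).smul_const E).const_add x
  have h1 : HasDerivAt (fun t : ℝ => ρ (x + t • E)) (fderiv ℝ ρ x E) 0 := by
    have hd : HasFDerivAt ρ (fderiv ℝ ρ x) (x + (0 : ℝ) • E) := by
      simpa using (hρ1.differentiable one_ne_zero x).hasFDerivAt
    exact hd.comp_hasDerivAt 0 hl
  have h2 : HasDerivAt (fun t : ℝ => ρ (x + t • E)) 1 0 := by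
    simp_rw [hc.shift]
    simpa using (hasDerivAt_id (0 : ℝ)).const_add (ρ x)
  exact h1.unique h2

/-- The fields `ζ (e_m - ∂_m ρ E)` are tangential. -/
lemma IsChart.isTangential {Ω : Set Vec} {x₀ : Vec} {r : ℝ} {ρ : Vec → ℝ} {E : Vec}
    (hc : IsChart Ω x₀ r ρ E) (ζ : ContDiffBump x₀) (hζ : ζ.rOut < r) (m : Fin 3) :
    IsTangential x₀ r ρ 2
      (fun i x => ζ x * ((if i = m then 1 else 0) - pderiv m ρ x * E i)) := by
  refine ⟨fun i => ζ.contDiff.mul (contDiff_const.sub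
    ((contDiff_pderiv hc.contDiff (by norm_num) m).mul contDiff_const)), fun i =>
    ζ.hasCompactSupport.mul_right, fun i => ?_, fun x => ?_⟩
  · refine (closure_mono fun x hx => left_ne_zero_of_mul hx).trans (?_ : tsupport ζ ⊆ _)
    rw [ζ.tsupport_eq]
    exact Metric.closedBall_subset_ball hζ
  · have : ∀ i, ζ x * ((if i = m then 1 else 0) - pderiv m ρ x * E i) * pderiv i ρ x =
        ζ x * ((if i = m then pderiv i ρ x else 0) - pderiv m ρ x * (E i * pderiv i ρ x)) := by
      intro i; split_ifs <;> ring
    simp_rw [this]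
    rw [← Finset.mul_sum, Finset.sum_sub_distrib, ← Finset.mul_sum, hc.sum_mul_pderiv_eq_one]
    simp

lemma IsScalarH2.integrableOn_hess {Ω : Set Vec} {w : Vec → ℝ} {p : Fin 3 → Vec → ℝ}
    {H : Fin 3 → Fin 3 → Vec → ℝ} (h : IsScalarH2 Ω w p H) :
    IntegrableOn (fun x => ∑ i, ∑ j, H i j x ^ 2) Ω :=
  integrable_finsetSum _ fun i _ => integrable_finsetSum _ fun j _ => (h.memLp_hess i j).integrable_sq

/-- The local form of the `H²` estimate. On the smaller ball the cutoff function is one, so that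
the three tangential fields `ζ (e_m - ∂_m ρ E)` see the full tangential part of the Hessian. -/
lemma integral_sq_hess_le_of_isChart {Ω : Set Vec} (hΩ : IsOpen Ω) {x₀ : Vec} {r : ℝ}
    {ρ : Vec → ℝ} {E : Vec} (hc : IsChart Ω x₀ r ρ E) :
    ∃ C : ℝ, 0 ≤ C ∧ ∀ (w : Vec → ℝ) (p : Fin 3 → Vec → ℝ) (H : Fin 3 → Fin 3 → Vec → ℝ),
      IsScalarH2 Ω w p H → HasZeroTangentialTrace Ω p →
      ∫ x in Ω ∩ Metric.ball x₀ (r / 2), ∑ i, ∑ j, H i j x ^ 2 ≤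
        C * ∫ x in Ω, (∑ i, p i x ^ 2 + (∑ i, H i i x) ^ 2) := by
  have hr := hc.pos
  let ζ : ContDiffBump x₀ := ⟨r / 2, 3 * r / 4, by linarith, by linarith⟩
  let τ : Fin 3 → Fin 3 → Vec → ℝ := fun m i x =>
    ζ x * ((if i = m then 1 else 0) - pderiv m ρ x * E i)
  have hτ : ∀ m, IsTangential x₀ r ρ 2 (τ m) := fun m =>
    hc.isTangential ζ (by change 3 * r / 4 < r; linarith) m
  have hτ1 : ∀ m i, ContDiff ℝ 1 (τ m i) := fun m i => ((hτ m).contDiff i).of_le (by norm_num)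
  obtain ⟨M₁, -, hM₁⟩ := exists_bound_of_hasCompactSupport (ι := Fin 3 × Fin 3)
    (f := fun k => τ k.1 k.2) (fun k => (hτ1 k.1 k.2).continuous)
    (fun k => (hτ k.1).hasCompactSupport k.2)
  obtain ⟨M₂, -, hM₂⟩ := exists_bound_of_hasCompactSupport (ι := Fin 3 × Fin 3 × Fin 3)
    (f := fun k => pderiv k.2.2 (τ k.1 k.2.1)) (fun k => continuous_pderiv (hτ1 k.1 k.2.1) k.2.2)
    (fun k => hasCompactSupport_pderiv ((hτ k.1).hasCompactSupport k.2.1) k.2.2)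
  set M := max M₁ M₂
  have hρ1 : ContDiff ℝ 1 ρ := hc.contDiff.of_le (by norm_num)
  have hR : ∃ R : ℝ, 1 ≤ R ∧ ∀ i, ∀ x ∈ Metric.ball x₀ (r / 2), |pderiv i ρ x| ≤ R := by
    choose R hR using fun i => (isCompact_closedBall x₀ (r / 2)).exists_bound_of_continuousOn
      (continuous_pderiv hρ1 i).continuousOn
    obtain ⟨R', hR'⟩ := (Set.finite_range R).bddAbove
    exact ⟨max R' 1, le_max_right _ _, fun i x hx =>
      ((hR i x (Metric.ball_subset_closedBall hx)).trans (hR' (mem_range_self i))).trans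
        (le_max_left _ _)⟩
  obtain ⟨R, hR1, hR⟩ := hR
  refine ⟨6000 * R ^ 6 * (1 + 3000 * M ^ 2), by positivity, fun w p H h h0 => ?_⟩
  set I := ∫ x in Ω, (∑ i, p i x ^ 2 + (∑ i, H i i x) ^ 2) with hI
  have hb : ∀ m, ∫ x in Ω, ∑ j, (∑ i, τ m i x * H i j x) ^ 2 ≤ 1000 * M ^ 2 * I := fun m =>
    integral_sq_tangential_hess_le hΩ hc (hτ m)
      (fun i x => (hM₁ (m, i) x).trans (le_max_left _ _))
      (fun i j x => (hM₂ (m, i, j) x).trans (le_max_right _ _)) h h0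
  have ib : ∀ m, IntegrableOn (fun x => ∑ j, (∑ i, τ m i x * H i j x) ^ 2) Ω := fun m =>
    integrable_finsetSum _ fun j _ => (memLp_finsetSum _ fun i _ =>
      (h.memLp_hess i j).mul_hasCompactSupport (hτ1 m i).continuous
        ((hτ m).hasCompactSupport i)).integrable_sq
  have iF : IntegrableOn (fun x => (∑ i, H i i x) ^ 2) Ω :=
    (memLp_finsetSum _ fun i _ => h.memLp_hess i i).integrable_sq
  have iG : IntegrableOn (fun x => 6000 * R ^ 6 * ((∑ i, H i i x) ^ 2 +
      ∑ m, ∑ j, (∑ i, τ m i x * H i j x) ^ 2)) Ω :=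
    (iF.add (integrable_finsetSum _ fun m _ => ib m)).const_mul _
  have hsub : Ω ∩ Metric.ball x₀ (r / 2) ⊆ Ω := inter_subset_left
  have hE : ∑ i, E i ^ 2 = 1 := by
    have := EuclideanSpace.real_norm_sq_eq E
    rw [hc.norm_dir] at this
    linarith
  calc ∫ x in Ω ∩ Metric.ball x₀ (r / 2), ∑ i, ∑ j, H i j x ^ 2
      ≤ ∫ x in Ω ∩ Metric.ball x₀ (r / 2), 6000 * R ^ 6 * ((∑ i, H i i x) ^ 2 +
          ∑ m, ∑ j, (∑ i, τ m i x * H i j x) ^ 2) := by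
        refine setIntegral_mono_on_ae (h.integrableOn_hess.mono_set hsub) (iG.mono_set hsub)
          (hΩ.measurableSet.inter measurableSet_ball) ?_
        have hs : ∀ᵐ x ∂(volume.restrict Ω), ∀ i j, H i j x = H j i x :=
          ae_all_iff.2 fun i => ae_all_iff.2 fun j => h.symm hΩ i j
        rw [ae_restrict_iff' hΩ.measurableSet] at hs
        filter_upwards [hs] with x hx hxm
        have hζ1 : ζ x = 1 := ζ.one_of_mem_closedBall (Metric.ball_subset_closedBall hxm.2)
        refine sum_sq_hess_le hR1 (hx hxm.1) (fun i => hR i x hxm.2) hE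
          (hc.sum_mul_pderiv_eq_one x) fun m j => ?_
        have : ∀ i, τ m i x * H i j x =
            (if i = m then H i j x else 0) - pderiv m ρ x * (E i * H i j x) := by
          intro i
          simp only [τ, hζ1]
          split_ifs <;> ring
        simp_rw [this]
        rw [Finset.sum_sub_distrib, ← Finset.mul_sum]
        simp
    _ ≤ ∫ x in Ω, 6000 * R ^ 6 * ((∑ i, H i i x) ^ 2 +
          ∑ m, ∑ j, (∑ i, τ m i x * H i j x) ^ 2) :=
        setIntegral_mono_set iG (ae_of_all _ fun x => by
          simp only [Pi.zero_apply]; positivity) hsub.eventuallyLE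
    _ = 6000 * R ^ 6 * ((∫ x in Ω, (∑ i, H i i x) ^ 2) +
          ∑ m, ∫ x in Ω, ∑ j, (∑ i, τ m i x * H i j x) ^ 2) := by
        rw [integral_const_mul, integral_add iF (integrable_finsetSum _ fun m _ => ib m),
          integral_finsetSum _ fun m _ => ib m]
    _ ≤ 6000 * R ^ 6 * (I + ∑ m : Fin 3, 1000 * M ^ 2 * I) := by
        have h1 : ∫ x in Ω, (∑ i, H i i x) ^ 2 ≤ I :=
          integral_mono iF h.integrableOn_data fun x => by
            simp only [le_add_iff_nonneg_left]; positivity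
        gcongr with m
        exact hb m
    _ = _ := by
        simp only [Finset.sum_const, Finset.card_univ, Fintype.card_fin, nsmul_eq_mul]
        push_cast; ring

/-- Interior points have charts as well: there `ρ` is an affine function that is positive on a ball
contained in `Ω`. At boundary points `ρ` is the height above the graph. -/
lemma exists_isChart {Ω : Set Vec} (hΩ : IsBoundedC31Domain Ω) {x₀ : Vec} (hx₀ : x₀ ∈ closure Ω) :
    ∃ (r : ℝ) (ρ : Vec → ℝ) (E : Vec), IsChart Ω x₀ r ρ E := by
  by_cases hx : x₀ ∈ Ω
  · obtain ⟨r, hr, hrΩ⟩ := Metric.isOpen_iff.1 hΩ.isOpen x₀ hx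
    refine ⟨r, fun x => x 2 - x₀ 2 + r, EuclideanSpace.single 2 1, hr, by fun_prop, by simp,
      fun x t => ?_, fun x hxb => ⟨fun _ => ?_, fun _ => hrΩ hxb⟩⟩
    · simp; ring
    · have h1 := (PiLp.norm_apply_le (x - x₀) 2).trans_lt (mem_ball_iff_norm.1 hxb)
      rw [PiLp.sub_apply, Real.norm_eq_abs] at h1
      linarith [(abs_lt.1 h1).1]
  · have hfr : x₀ ∈ frontier Ω := ⟨hx₀, by rwa [hΩ.isOpen.interior_eq]⟩
    obtain ⟨e, r, ψ, L, hr, hψ, -, hmem⟩ := hΩ.boundary x₀ hfr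
    have he : ContDiff ℝ 3 e := (⟨e.toAffineEquiv.toAffineMap, e.continuous⟩ : Vec →ᴬ[ℝ] Vec).contDiff
    have hei : ∀ i, ContDiff ℝ 3 fun x => e x i := fun i =>
      (contDiff_euclidean.1 he) i
    refine ⟨r, fun x => e x 2 - ψ !₂[e x 0, e x 1], e.linearIsometryEquiv.symm
      (EuclideanSpace.single 2 1), hr, ?_, by simp, fun x t => ?_, fun x hxb => ?_⟩
    · refine (hei 2).sub (hψ.comp ?_)
      refine contDiff_euclidean.2 fun i => ?_
      fin_cases i
      · exact hei 0
      · exact hei 1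
    · have h1 : e (x + t • e.linearIsometryEquiv.symm (EuclideanSpace.single 2 1)) =
          e x + t • EuclideanSpace.single 2 1 := by
        have := e.map_vadd x (t • e.linearIsometryEquiv.symm (EuclideanSpace.single 2 1))
        rw [vadd_eq_add, vadd_eq_add, add_comm] at this
        rw [this, map_smul, LinearIsometryEquiv.apply_symm_apply, add_comm]
      rw [h1]
      simp
      ring
    · rw [hmem x hxb, sub_pos]

/-- The `H²` estimate: functions vanishing on `∂Ω` have their second derivatives controlled by the
Laplacian and the gradient. -/
theorem exists_integral_sq_hess_le {Ω : Set Vec} (hΩ : IsBoundedC31Domain Ω) :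
    ∃ C : ℝ, 0 ≤ C ∧ ∀ (w : Vec → ℝ) (p : Fin 3 → Vec → ℝ) (H : Fin 3 → Fin 3 → Vec → ℝ),
      IsScalarH2 Ω w p H → HasZeroTangentialTrace Ω p →
      ∫ x in Ω, ∑ i, ∑ j, H i j x ^ 2 ≤
        C * ∫ x in Ω, (∑ i, p i x ^ 2 + (∑ i, H i i x) ^ 2) := by
  have hcomp : IsCompact (closure Ω) := hΩ.isBounded.isCompact_closure
  choose! r ρ E hc using fun x (hx : x ∈ closure Ω) => exists_isChart hΩ hx
  choose! C hC0 hC using fun x (hx : x ∈ closure Ω) =>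
    integral_sq_hess_le_of_isChart hΩ.isOpen (hc x hx)
  obtain ⟨t, ht, hcov⟩ := hcomp.elim_nhds_subcover (fun x => Metric.ball x (r x / 2))
    fun x hx => Metric.ball_mem_nhds _ (half_pos (hc x hx).pos)
  refine ⟨∑ x ∈ t, C x, Finset.sum_nonneg fun x hx => hC0 x (ht x hx), fun w p H h h0 => ?_⟩
  have hΩeq : Ω = ⋃ x ∈ t, Ω ∩ Metric.ball x (r x / 2) := by
    rw [← inter_iUnion₂]
    exact (inter_eq_left.2 (subset_closure.trans hcov)).symm
  have hnn : ∀ x, 0 ≤ ∑ i, ∑ j, H i j x ^ 2 := fun x => by positivity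
  -- the cover overlaps, so subadditivity is used for the lower integral
  have hle : (∫⁻ x in Ω, ENNReal.ofReal (∑ i, ∑ j, H i j x ^ 2)) ≤
      ∑ y ∈ t, ∫⁻ x in Ω ∩ Metric.ball y (r y / 2), ENNReal.ofReal (∑ i, ∑ j, H i j x ^ 2) := by
    conv_lhs => rw [hΩeq, ← Finset.set_biUnion_coe, biUnion_eq_iUnion]
    exact (lintegral_iUnion_le _ _).trans_eq (Finset.tsum_subtype t fun y =>
      ∫⁻ x in Ω ∩ Metric.ball y (r y / 2), ENNReal.ofReal (∑ i, ∑ j, H i j x ^ 2))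
  have hint := fun y => h.integrableOn_hess.mono_set
    (inter_subset_left (s := Ω) (t := Metric.ball y (r y / 2)))
  have e1 : ∀ y, (∫⁻ x in Ω ∩ Metric.ball y (r y / 2), ENNReal.ofReal (∑ i, ∑ j, H i j x ^ 2)) =
      ENNReal.ofReal (∫ x in Ω ∩ Metric.ball y (r y / 2), ∑ i, ∑ j, H i j x ^ 2) := fun y =>
    (ofReal_integral_eq_lintegral_ofReal (hint y) (ae_of_all _ hnn)).symm
  simp_rw [e1] at hle
  rw [← ofReal_integral_eq_lintegral_ofReal h.integrableOn_hess (ae_of_all _ hnn),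
    ← ENNReal.ofReal_sum_of_nonneg fun y _ => integral_nonneg hnn,
    ENNReal.ofReal_le_ofReal_iff (Finset.sum_nonneg fun y _ => integral_nonneg hnn)] at hle
  refine hle.trans ?_
  rw [Finset.sum_mul]
  exact Finset.sum_le_sum fun y hy => hC y (ht y hy) w p H h h0

/-- The gradient of a function in `H¹₀` is a limit of gradients of test functions, and integration
by parts against those is free of boundary terms. -/
lemma IsH10.hasZeroTangentialTrace {Ω : Set Vec} {w : Vec → Vec} {Dw : Vec → Mat}
    (h : IsH10 Ω w Dw) (hD : MemLp Dw 2 (volume.restrict Ω)) (a : Fin 3) :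
    HasZeroTangentialTrace Ω (fun i x => Dw x (a, i)) := by
  obtain ⟨φ, hφ, -, hlim⟩ := h
  intro g hg hgs i k
  have hφa : ∀ n, ContDiff ℝ ∞ (fun x => φ n x a) := fun n => contDiff_euclidean.1 (hφ n).smooth a
  have hsub : ∀ n, tsupport (fun x => φ n x a) ⊆ tsupport (φ n) := fun n =>
    closure_mono fun x hx h0 => hx (by simp only [h0, PiLp.zero_apply])
  have hφs : ∀ n, HasCompactSupport (fun x => φ n x a) := fun n =>
    (hφ n).hasCompactSupport.of_isClosed_subset (isClosed_tsupport _) (hsub n)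
  have hg1 : ContDiff ℝ 1 g := hg.of_le (by norm_num)
  have key : ∀ n, ∫ x in Ω, pderiv i (fun y => φ n y a) x * pderiv k g x =
      ∫ x in Ω, pderiv k (fun y => φ n y a) x * pderiv i g x := by
    intro n
    have hz : ∀ l m, ∀ x ∉ Ω, pderiv l (fun y => φ n y a) x * pderiv m g x = 0 := fun l m x hx => by
      rw [pderiv_eq_zero_of_notMem fun hm => hx ((hφ n).tsupport_subset (hsub n hm)), zero_mul]
    rw [setIntegral_eq_integral_of_forall_compl_eq_zero (hz i k),
      setIntegral_eq_integral_of_forall_compl_eq_zero (hz k i)]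
    have hd : ∀ l, ContDiff ℝ 1 (pderiv l g) := fun l => contDiff_pderiv hg (by norm_num) l
    have e : ∀ l m, ∫ x, pderiv l (fun y => φ n y a) x * pderiv m g x =
        - ∫ x, φ n x a * pderiv l (pderiv m g) x := fun l m => by
      rw [integral_mul_pderiv ((hφa n).of_le (by simp)) (hd m) (hasCompactSupport_pderiv hgs m) l,
        neg_neg]
    rw [e, e]
    simp_rw [pderiv_comm hg i k]
  have lim : ∀ l m, Tendsto (fun n => ∫ x in Ω, pderiv l (fun y => φ n y a) x * pderiv m g x) atTop
      (𝓝 (∫ x in Ω, Dw x (a, l) * pderiv m g x)) := by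
    intro l m
    have hG : MemLp (pderiv m g) 2 (volume.restrict Ω) := (memLp_of_hasCompactSupport
      (continuous_pderiv hg1 m) (hasCompactSupport_pderiv hgs m)).restrict Ω
    have hDl : MemLp (fun x => Dw x (a, l)) 2 (volume.restrict Ω) := hD.eval_piLp (a, l)
    have hφl : ∀ n, MemLp (pderiv l (fun y => φ n y a)) 2 (volume.restrict Ω) := fun n =>
      (memLp_of_hasCompactSupport (continuous_pderiv ((hφa n).of_le (by simp)) l)
        (hasCompactSupport_pderiv (hφs n) l)).restrict Ω
    refine tendsto_integral_of_L1' _ (hDl.integrable_mul hG).1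
      (Eventually.of_forall fun n => (hφl n).integrable_mul hG) ?_
    have hb : ∀ n, eLpNorm ((fun x => pderiv l (fun y => φ n y a) x * pderiv m g x) -
        fun x => Dw x (a, l) * pderiv m g x) 1 (volume.restrict Ω) ≤
        eLpNorm (classicalGrad (φ n) - Dw) 2 (volume.restrict Ω) *
          eLpNorm (pderiv m g) 2 (volume.restrict Ω) := by
      intro n
      have e1 : ((fun x => pderiv l (fun y => φ n y a) x * pderiv m g x) -
          fun x => Dw x (a, l) * pderiv m g x) =
          (fun x => pderiv l (fun y => φ n y a) x - Dw x (a, l)) • pderiv m g := by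
        ext x; simp only [Pi.sub_apply, Pi.smul_apply', smul_eq_mul]; ring
      rw [e1]
      refine (eLpNorm_smul_le_mul_eLpNorm hG.1 ((hφl n).1.sub hDl.1)
        (p := 2) (q := 2)).trans ?_
      gcongr
      refine eLpNorm_mono fun x => ?_
      have := PiLp.norm_apply_le (classicalGrad (φ n) x - Dw x) (a, l)
      simpa [classicalGrad] using this
    refine tendsto_of_tendsto_of_tendsto_of_le_of_le tendsto_const_nhds ?_ (fun n => zero_le) hb
    have := ENNReal.Tendsto.mul_const hlim (b := eLpNorm (pderiv m g) 2 (volume.restrict Ω))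
      (Or.inr hG.2.ne)
    rwa [zero_mul] at this
  exact tendsto_nhds_unique ((lim i k).congr key) (lim k i)

/-! ### Estimates for vector fields -/

lemma norm_sq_mat (A : Mat) : ‖A‖ ^ 2 = ∑ a, ∑ i, A (a, i) ^ 2 := by
  rw [EuclideanSpace.real_norm_sq_eq, Fintype.sum_prod_type]

lemma norm_sq_tens (Γ : Tens) : ‖Γ‖ ^ 2 = ∑ a, ∑ i, ∑ j, Γ (a, i, j) ^ 2 := by
  rw [EuclideanSpace.real_norm_sq_eq, Fintype.sum_prod_type]
  simp_rw [Fintype.sum_prod_type]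

lemma norm_sq_lap (Γ : Tens) : ‖lap Γ‖ ^ 2 = ∑ a, (∑ i, Γ (a, i, i)) ^ 2 :=
  EuclideanSpace.real_norm_sq_eq _

lemma norm_sq_lap_le (Γ : Tens) : ‖lap Γ‖ ^ 2 ≤ 3 * ‖Γ‖ ^ 2 := by
  rw [norm_sq_lap, norm_sq_tens, Finset.mul_sum]
  refine Finset.sum_le_sum fun a _ => ?_
  have h := sq_sum_le_card_mul_sum_sq (s := Finset.univ) (f := fun i => Γ (a, i, i))
  simp only [Finset.card_univ, Fintype.card_fin] at h
  refine h.trans ?_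
  push_cast
  gcongr with i
  exact Finset.single_le_sum (f := fun j => Γ (a, i, j) ^ 2) (fun j _ => sq_nonneg _)
    (Finset.mem_univ i)

lemma lap_sub (Γ Γ' : Tens) : lap (Γ - Γ') = lap Γ - lap Γ' := by
  ext a; simp [lap]

lemma continuous_lap : Continuous lap :=
  (PiLp.continuous_toLp 2 _).comp (continuous_pi fun i => continuous_finsetSum _ fun j _ => by
    fun_prop)

lemma norm_sub_sq_le {F : Type*} [NormedAddCommGroup F] (a b : F) :
    ‖a - b‖ ^ 2 ≤ 2 * ‖a‖ ^ 2 + 2 * ‖b‖ ^ 2 := by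
  have := pow_le_pow_left₀ (norm_nonneg _) (norm_sub_le a b) 2
  nlinarith [sq_nonneg (‖a‖ - ‖b‖)]

lemma HasWeakPDeriv.sub {Ω : Set Vec} (hΩ : IsOpen Ω) {j : Fin 3} {u v u' v' : Vec → ℝ}
    (h : HasWeakPDeriv Ω j u v) (h' : HasWeakPDeriv Ω j u' v') :
    HasWeakPDeriv Ω j (fun x => u x - u' x) (fun x => v x - v' x) := by
  refine ⟨h.locallyIntegrable.sub h'.locallyIntegrable,
    h.locallyIntegrable_deriv.sub h'.locallyIntegrable_deriv, fun φ hφ => ?_⟩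
  have hi : ∀ {f c : Vec → ℝ}, LocallyIntegrableOn f Ω → Continuous c → tsupport c ⊆ tsupport φ →
      IntegrableOn (fun x => f x * c x) Ω := by
    intro f c hf hc hs
    have h1 : IntegrableOn (fun x => f x * c x) (tsupport φ) :=
      (hf.integrableOn_compact_subset hφ.tsupport_subset hφ.hasCompactSupport).mul_continuousOn
        hc.continuousOn hφ.hasCompactSupport
    exact h1.of_forall_sdiff_eq_zero hΩ.measurableSet fun x hx => by
      rw [image_eq_zero_of_notMem_tsupport fun h => hx.2 (hs h), mul_zero]
  have c1 := continuous_pderiv (hφ.smooth.of_le (by simp)) j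
  have s1 := tsupport_pderiv_subset φ j
  simp_rw [sub_mul]
  rw [integral_sub (hi h.locallyIntegrable c1 s1) (hi h'.locallyIntegrable c1 s1),
    integral_sub (hi h.locallyIntegrable_deriv hφ.smooth.continuous subset_rfl)
      (hi h'.locallyIntegrable_deriv hφ.smooth.continuous subset_rfl),
    h.integral_eq φ hφ, h'.integral_eq φ hφ]
  ring

lemma IsH2.isScalarH2 {Ω : Set Vec} {u : Vec → Vec} {Du : Vec → Mat} {D2u : Vec → Tens}
    (h : IsH2 Ω u Du D2u) (a : Fin 3) :
    IsScalarH2 Ω (fun x => u x a) (fun i x => Du x (a, i)) (fun i j x => D2u x (a, i, j)) :=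
  ⟨fun i => h.derivs.grad a i, fun i j => h.derivs.hess a i j, fun i => h.memLp_grad.eval_piLp (a, i),
    fun i j => h.memLp_hess.eval_piLp (a, i, j)⟩

lemma IsH2.sub {Ω : Set Vec} (hΩ : IsOpen Ω) {u v : Vec → Vec} {Du Dv : Vec → Mat}
    {D2u D2v : Vec → Tens} (h : IsH2 Ω u Du D2u) (h' : IsH2 Ω v Dv D2v) :
    IsH2 Ω (u - v) (Du - Dv) (D2u - D2v) :=
  ⟨⟨fun i j => (h.derivs.grad i j).sub hΩ (h'.derivs.grad i j),
    fun i j k => (h.derivs.hess i j k).sub hΩ (h'.derivs.hess i j k)⟩,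
    h.memLp.sub h'.memLp, h.memLp_grad.sub h'.memLp_grad, h.memLp_hess.sub h'.memLp_hess⟩

lemma memLp_lap {α : Type*} {m : MeasurableSpace α} {μ : Measure α} {Γ : α → Tens}
    (h : MemLp Γ 2 μ) : MemLp (fun x => lap (Γ x)) 2 μ := by
  refine h.of_le_mul (c := 2) (continuous_lap.comp_aestronglyMeasurable h.1) (ae_of_all _ fun x => ?_)
  refine abs_le_of_sq_le_sq' ?_ (by positivity) |>.2
  have := norm_sq_lap_le (Γ x)
  nlinarith [sq_nonneg ‖Γ x‖]

/-- The `H²` estimate for vector fields with the boundary values of `g`. -/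
theorem exists_integral_norm_sq_hess_le {Ω : Set Vec} (hΩ : IsBoundedC31Domain Ω) :
    ∃ C : ℝ, 0 ≤ C ∧ ∀ (u g : Vec → Vec) (Du Dg : Vec → Mat) (D2u D2g : Vec → Tens),
      IsH2 Ω u Du D2u → IsH2 Ω g Dg D2g → IsH10 Ω (u - g) (Du - Dg) →
      ∫ x in Ω, ‖D2u x‖ ^ 2 ≤ C * ((∫ x in Ω, ‖lap (D2u x)‖ ^ 2) + (∫ x in Ω, ‖Du x‖ ^ 2) +
        ((∫ x in Ω, ‖D2g x‖ ^ 2) + ∫ x in Ω, ‖Dg x‖ ^ 2)) := by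
  obtain ⟨C, hC0, hC⟩ := exists_integral_sq_hess_le hΩ
  refine ⟨12 * C + 2, by positivity, fun u g Du Dg D2u D2g hu hg h0 => ?_⟩
  have hw := hu.sub hΩ.isOpen hg
  have hest := fun a => hC _ _ _ (hw.isScalarH2 a) (h0.hasZeroTangentialTrace hw.memLp_grad a)
  have hsum := Finset.sum_le_sum (s := Finset.univ) fun a _ => hest a
  rw [← Finset.mul_sum, ← integral_finsetSum _ fun a _ => (hw.isScalarH2 a).integrableOn_hess,
    ← integral_finsetSum _ fun a _ => (hw.isScalarH2 a).integrableOn_data] at hsum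
  simp_rw [Finset.sum_add_distrib, ← norm_sq_tens, ← norm_sq_mat, ← norm_sq_lap] at hsum
  have n : ∀ {F : Type} [NormedAddCommGroup F] {f : Vec → F}, MemLp f 2 (volume.restrict Ω) →
      IntegrableOn (fun x => ‖f x‖ ^ 2) Ω := fun hf => hf.norm.integrable_sq
  have i1 := n hu.memLp_hess
  have i2 := n hg.memLp_hess
  have i3 := n hu.memLp_grad
  have i4 := n hg.memLp_grad
  have i5 := n (memLp_lap hu.memLp_hess)
  -- split the data of `u - g` into those of `u` and of `g`
  have e1 : ∫ x in Ω, (‖(Du - Dg) x‖ ^ 2 + ‖lap ((D2u - D2g) x)‖ ^ 2) ≤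
      ∫ x in Ω, ((2 * ‖Du x‖ ^ 2 + 2 * ‖Dg x‖ ^ 2) + (2 * ‖lap (D2u x)‖ ^ 2 + 6 * ‖D2g x‖ ^ 2)) := by
    refine integral_mono ((n hw.memLp_grad).add (n (memLp_lap hw.memLp_hess)))
      (((i3.const_mul _).add (i4.const_mul _)).add ((i5.const_mul _).add (i2.const_mul _)))
      fun x => ?_
    have a1 := norm_sub_sq_le (Du x) (Dg x)
    have a2 := norm_sub_sq_le (lap (D2u x)) (lap (D2g x))
    have a3 := norm_sq_lap_le (D2g x)
    simp only [Pi.sub_apply, lap_sub]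
    linarith
  have e2 : ∫ x in Ω, ‖D2u x‖ ^ 2 ≤ ∫ x in Ω, (2 * ‖(D2u - D2g) x‖ ^ 2 + 2 * ‖D2g x‖ ^ 2) := by
    refine integral_mono i1 (((n hw.memLp_hess).const_mul _).add (i2.const_mul _)) fun x => ?_
    have := norm_sub_sq_le ((D2u - D2g) x) (-(D2g x))
    simp only [norm_neg, sub_neg_eq_add, Pi.sub_apply, sub_add_cancel] at this ⊢
    exact this
  have s1 := integral_add ((i3.const_mul 2).add (i4.const_mul 2))
    ((i5.const_mul 2).add (i2.const_mul 6))
  have s2 := integral_add (i3.const_mul 2) (i4.const_mul 2)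
  have s3 := integral_add (i5.const_mul 2) (i2.const_mul 6)
  simp only [Pi.add_apply, integral_const_mul] at s1 s2 s3
  rw [s1, s2, s3] at e1
  rw [integral_add ((n hw.memLp_hess).const_mul _) (i2.const_mul _), integral_const_mul,
    integral_const_mul] at e2
  have nn : ∀ {F : Type} [NormedAddCommGroup F] (f : Vec → F), 0 ≤ ∫ x in Ω, ‖f x‖ ^ 2 := fun f =>
    integral_nonneg fun x => sq_nonneg _
  have p1 := nn D2g
  have p2 := nn Du
  have p3 := nn Dg
  have p4 := nn fun x => lap (D2u x)
  have e3 := mul_le_mul_of_nonneg_left e1 hC0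
  nlinarith [mul_nonneg hC0 p1, mul_nonneg hC0 p2, mul_nonneg hC0 p3, mul_nonneg hC0 p4]

/-! ### Interior comparison of the Hessian and the Laplacian -/

/-- The div-curl identity: since `H i = ∇ (p i)` is a gradient, `H i j ∂_i v` and `H i i ∂_j v`
have the same integral for `v = φ p j`, which is approximated by test functions. -/
lemma integral_hess_mul_hess {Ω : Set Vec} (hΩ : IsOpen Ω) {w : Vec → ℝ} {p : Fin 3 → Vec → ℝ}
    {H : Fin 3 → Fin 3 → Vec → ℝ} (h : IsScalarH2 Ω w p H) {φ : Vec → ℝ} (hφ : IsTestFunction Ω φ)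
    (i j : Fin 3) :
    ∫ x in Ω, H i j x * (pderiv i φ x * p j x + φ x * H j i x) =
      ∫ x in Ω, H i i x * (pderiv j φ x * p j x + φ x * H j j x) := by
  have hm := hΩ.measurableSet
  have hφ1 : ContDiff ℝ 1 φ := hφ.smooth.of_le (by simp)
  have hφs := hφ.hasCompactSupport
  let V : Fin 3 → Vec → ℝ := fun k x => pderiv k φ x * p j x + φ x * H j k x
  have m1 : ∀ k, MemLp (fun x => pderiv k φ x * p j x) 2 (volume.restrict Ω) := fun k =>
    (h.memLp_grad j).mul_hasCompactSupport (continuous_pderiv hφ1 k) (hasCompactSupport_pderiv hφs k)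
  have m2 : ∀ k, MemLp (fun x => φ x * H j k x) 2 (volume.restrict Ω) := fun k =>
    (h.memLp_hess j k).mul_hasCompactSupport hφ1.continuous hφs
  obtain ⟨χ, hχ, hlim⟩ := exists_isTestFunction_tendsto_of_subset hΩ hφs hφ.tsupport_subset
    (U := Ω.indicator fun x => φ x * p j x) (V := fun k => Ω.indicator (V k))
    (memLp_indicator hm ((h.memLp_grad j).mul_hasCompactSupport hφ1.continuous hφs))
    (fun k => memLp_indicator hm ((m1 k).add (m2 k)))
    (fun k χ hχ hχs => by
      have hχ1 : ContDiff ℝ 1 χ := hχ.of_le (by simp)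
      rw [integral_indicator_mul hm, integral_indicator_mul hm]
      have ht : IsTestFunction Ω (fun x => φ x * χ x) := ⟨hφ.smooth.mul hχ, hφs.mul_right,
        (closure_mono fun x hx => left_ne_zero_of_mul hx).trans hφ.tsupport_subset⟩
      have e := (h.hess j k).integral_eq _ ht
      simp_rw [pderiv_mul hφ1 hχ1, mul_add] at e
      have c1 : Continuous fun x => pderiv k φ x * χ x :=
        (continuous_pderiv hφ1 k).mul hχ.continuous
      have c2 : Continuous fun x => φ x * pderiv k χ x :=
        hφ1.continuous.mul (continuous_pderiv hχ1 k)
      rw [integral_add (integrableOn_mul_of_hasCompactSupport (h.memLp_grad j) c1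
        (hasCompactSupport_pderiv hφs k).mul_right)
        (integrableOn_mul_of_hasCompactSupport (h.memLp_grad j) c2 hφs.mul_right)] at e
      have e2 := integral_add (integrableOn_mul_of_hasCompactSupport (m1 k) hχ.continuous hχs)
        (integrableOn_mul_of_hasCompactSupport (m2 k) hχ.continuous hχs)
      simp_rw [V, add_mul]
      rw [e2]
      have r1 : ∀ x, pderiv k φ x * p j x * χ x = p j x * (pderiv k φ x * χ x) := fun x => by ring
      have r2 : ∀ x, φ x * H j k x * χ x = H j k x * (φ x * χ x) := fun x => by ring
      have r3 : ∀ x, φ x * p j x * pderiv k χ x = p j x * (φ x * pderiv k χ x) := fun x => by ring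
      simp_rw [r1, r2, r3]
      linarith)
    (fun x hx => by
      by_cases hxΩ : x ∈ Ω
      · rw [indicator_of_mem hxΩ, image_eq_zero_of_notMem_tsupport hx, zero_mul]
      · exact indicator_of_notMem hxΩ _)
  have key : ∀ n, ∫ x in Ω, H i j x * pderiv i (χ n) x = ∫ x in Ω, H i i x * pderiv j (χ n) x := by
    intro n
    have e1 := (h.hess i j).integral_eq _ ((hχ n).pderiv i)
    have e2 := (h.hess i i).integral_eq _ ((hχ n).pderiv j)
    simp_rw [pderiv_comm ((hχ n).smooth.of_le (by norm_cast)) i j] at e2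
    linarith
  have l1 := (hlim _ (memLp_indicator hm (h.memLp_hess i j))).2 i
  have l2 := (hlim _ (memLp_indicator hm (h.memLp_hess i i))).2 j
  simp only [integral_indicator_mul_indicator hm] at l1 l2
  simp only [integral_indicator_mul hm] at l1 l2
  exact tendsto_nhds_unique (l1.congr key) l2

/-- The scalar form of `abs_integral_mul_norm_sq_hess_sub_le`: after two integrations by parts the
derivative falls on `φ`, and Young's inequality with parameter `ε` separates the factors. -/
lemma abs_integral_mul_hess_sub_lap_le {Ω : Set Vec} (hΩ : IsOpen Ω) {w : Vec → ℝ}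
    {p : Fin 3 → Vec → ℝ} {H : Fin 3 → Fin 3 → Vec → ℝ} (h : IsScalarH2 Ω w p H) {φ : Vec → ℝ}
    (hφ : IsTestFunction Ω φ) {M : ℝ} (hM : ∀ i x, |pderiv i φ x| ≤ M) {ε : ℝ} (hε : 0 < ε) :
    |∫ x in Ω, φ x * (∑ i, ∑ j, H i j x ^ 2 - (∑ i, H i i x) ^ 2)| ≤
      ∫ x in Ω, M * (3 * ε⁻¹ * ∑ i, p i x ^ 2 + 2 * ε * ∑ i, ∑ j, H i j x ^ 2) := by
  have hφ1 : ContDiff ℝ 1 φ := hφ.smooth.of_le (by simp)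
  have hφs := hφ.hasCompactSupport
  have m1 : ∀ k j, MemLp (fun x => pderiv k φ x * p j x) 2 (volume.restrict Ω) := fun k j =>
    (h.memLp_grad j).mul_hasCompactSupport (continuous_pderiv hφ1 k) (hasCompactSupport_pderiv hφs k)
  have m2 : ∀ j k, MemLp (fun x => φ x * H j k x) 2 (volume.restrict Ω) := fun j k =>
    (h.memLp_hess j k).mul_hasCompactSupport hφ1.continuous hφs
  have I1 : ∀ a b k j, IntegrableOn (fun x => H a b x * (pderiv k φ x * p j x)) Ω := fun a b k j =>
    (h.memLp_hess a b).integrable_mul (m1 k j)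
  have I2 : ∀ a b k j, IntegrableOn (fun x => H a b x * (φ x * H k j x)) Ω := fun a b k j =>
    (h.memLp_hess a b).integrable_mul (m2 k j)
  let G : Fin 3 → Fin 3 → Vec → ℝ := fun i j x =>
    H i i x * (pderiv j φ x * p j x) - H i j x * (pderiv i φ x * p j x)
  have iGij : ∀ i j, IntegrableOn (G i j) Ω := fun i j => (I1 i i j j).sub (I1 i j i j)
  have iF : ∀ i j, IntegrableOn (fun x => H i j x * (φ x * H j i x) - H i i x * (φ x * H j j x)) Ω :=
    fun i j => (I2 i j j i).sub (I2 i i j j)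
  have iG : IntegrableOn (fun x => ∑ i, ∑ j, G i j x) Ω :=
    integrable_finsetSum _ fun i _ => integrable_finsetSum _ fun j _ => iGij i j
  have hij : ∀ i j, ∫ x in Ω, (H i j x * (φ x * H j i x) - H i i x * (φ x * H j j x)) =
      ∫ x in Ω, G i j x := by
    intro i j
    have e := integral_hess_mul_hess hΩ h hφ i j
    simp_rw [mul_add] at e
    rw [integral_add (I1 i j i j) (I2 i j j i), integral_add (I1 i i j j) (I2 i i j j)] at e
    simp only [G]
    rw [integral_sub (I2 i j j i) (I2 i i j j), integral_sub (I1 i i j j) (I1 i j i j)]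
    linarith
  have hs : ∀ᵐ x ∂(volume.restrict Ω), ∀ i j, H i j x = H j i x :=
    ae_all_iff.2 fun i => ae_all_iff.2 fun j => h.symm hΩ i j
  have e1 : ∫ x in Ω, φ x * (∑ i, ∑ j, H i j x ^ 2 - (∑ i, H i i x) ^ 2) =
      ∫ x in Ω, ∑ i, ∑ j, G i j x := by
    calc _ = ∫ x in Ω, ∑ i, ∑ j, (H i j x * (φ x * H j i x) - H i i x * (φ x * H j j x)) := by
          refine integral_congr_ae ?_
          filter_upwards [hs] with x hx
          rw [sq (∑ i, H i i x), Finset.sum_mul_sum, ← Finset.sum_sub_distrib, Finset.mul_sum]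
          refine Finset.sum_congr rfl fun i _ => ?_
          rw [← Finset.sum_sub_distrib, Finset.mul_sum]
          refine Finset.sum_congr rfl fun j _ => ?_
          rw [hx j i]; ring
      _ = _ := by
          rw [integral_finsetSum _ fun i _ => integrable_finsetSum _ fun j _ => iF i j,
            integral_finsetSum _ fun i _ => integrable_finsetSum _ fun j _ => iGij i j]
          refine Finset.sum_congr rfl fun i _ => ?_
          rw [integral_finsetSum _ fun j _ => iF i j, integral_finsetSum _ fun j _ => iGij i j]
          exact Finset.sum_congr rfl fun j _ => hij i j
  have hM0 : 0 ≤ M := (abs_nonneg _).trans (hM 0 0)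
  have hY : ∀ a b : ℝ, |a| * |b| ≤ (ε⁻¹ * b ^ 2 + ε * a ^ 2) / 2 := by
    intro a b
    have h1 := sq_nonneg (ε * |a| - |b|)
    have h2 : ε⁻¹ * (ε * |a| - |b|) ^ 2 = ε * a ^ 2 - 2 * (|a| * |b|) + ε⁻¹ * b ^ 2 := by
      rw [← sq_abs a, ← sq_abs b]; field_simp
      ring
    have h3 := mul_nonneg (inv_pos.2 hε).le h1
    linarith
  have hGp : ∀ x, |∑ i, ∑ j, G i j x| ≤
      M * (3 * ε⁻¹ * ∑ i, p i x ^ 2 + 2 * ε * ∑ i, ∑ j, H i j x ^ 2) := by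
    intro x
    have hb : ∀ i j, |G i j x| ≤ M * (ε⁻¹ * p j x ^ 2 + ε / 2 * (H i i x ^ 2 + H i j x ^ 2)) := by
      intro i j
      have b : ∀ a k, |a * (pderiv k φ x * p j x)| ≤ M * ((ε⁻¹ * p j x ^ 2 + ε * a ^ 2) / 2) := by
        intro a k
        have : |a * (pderiv k φ x * p j x)| = |pderiv k φ x| * (|a| * |p j x|) := by
          rw [abs_mul, abs_mul]; ring
        rw [this]
        exact mul_le_mul (hM k x) (hY _ _) (by positivity) hM0
      refine (abs_sub _ _).trans ((add_le_add (b _ _) (b _ _)).trans (le_of_eq ?_))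
      ring
    have hd : ∀ i, H i i x ^ 2 ≤ ∑ j, H i j x ^ 2 := fun i =>
      Finset.single_le_sum (f := fun j => H i j x ^ 2) (fun j _ => sq_nonneg _) (Finset.mem_univ i)
    have hd2 := Finset.sum_le_sum (s := Finset.univ) fun i _ => hd i
    calc |∑ i, ∑ j, G i j x| ≤ ∑ i, ∑ j, |G i j x| :=
          (Finset.abs_sum_le_sum_abs _ _).trans
            (Finset.sum_le_sum fun i _ => Finset.abs_sum_le_sum_abs _ _)
      _ ≤ ∑ i, ∑ j, M * (ε⁻¹ * p j x ^ 2 + ε / 2 * (H i i x ^ 2 + H i j x ^ 2)) :=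
          Finset.sum_le_sum fun i _ => Finset.sum_le_sum fun j _ => hb i j
      _ = M * (3 * ε⁻¹ * ∑ j, p j x ^ 2 +
            ε / 2 * (3 * ∑ i, H i i x ^ 2 + ∑ i, ∑ j, H i j x ^ 2)) := by
          simp_rw [← Finset.mul_sum, Finset.sum_add_distrib, ← Finset.mul_sum, Finset.sum_add_distrib]
          simp only [Finset.sum_const, Finset.card_univ, Fintype.card_fin, nsmul_eq_mul,
            ← Finset.mul_sum]
          push_cast; ring
      _ ≤ _ := by
          refine mul_le_mul_of_nonneg_left ?_ hM0
          nlinarith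
  have iR : IntegrableOn (fun x => M * (3 * ε⁻¹ * ∑ i, p i x ^ 2 +
      2 * ε * ∑ i, ∑ j, H i j x ^ 2)) Ω :=
    (((integrable_finsetSum _ fun i _ => (h.memLp_grad i).integrable_sq).const_mul _).add
      (h.integrableOn_hess.const_mul _)).const_mul _
  rw [e1]
  exact (abs_integral_le_integral_abs).trans (integral_mono iG.abs iR hGp)

/-- In the interior, the densities `‖D²u‖²` and `‖Δu‖²` differ by a divergence, which is of lower
order. -/
theorem abs_integral_mul_norm_sq_hess_sub_le {Ω : Set Vec} (hΩ : IsOpen Ω) {u : Vec → Vec}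
    {Du : Vec → Mat} {D2u : Vec → Tens} (hu : IsH2 Ω u Du D2u) {φ : Vec → ℝ}
    (hφ : IsTestFunction Ω φ) {M : ℝ} (hM : ∀ i x, |pderiv i φ x| ≤ M) {ε : ℝ} (hε : 0 < ε) :
    |∫ x in Ω, φ x * (‖D2u x‖ ^ 2 - ‖lap (D2u x)‖ ^ 2)| ≤
      M * (3 * ε⁻¹ * (∫ x in Ω, ‖Du x‖ ^ 2) + 2 * ε * ∫ x in Ω, ‖D2u x‖ ^ 2) := by
  have hφc := hφ.smooth.continuous
  have hφs := hφ.hasCompactSupport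
  have key := Finset.sum_le_sum (s := Finset.univ) fun a _ =>
    abs_integral_mul_hess_sub_lap_le hΩ (hu.isScalarH2 a) hφ hM hε
  have iL : ∀ a, IntegrableOn (fun x => φ x * (∑ i, ∑ j, D2u x (a, i, j) ^ 2 -
      (∑ i, D2u x (a, i, i)) ^ 2)) Ω := by
    intro a
    have h := hu.isScalarH2 a
    have : Integrable (fun x => ∑ i, ∑ j, D2u x (a, i, j) ^ 2 - (∑ i, D2u x (a, i, i)) ^ 2)
        (volume.restrict Ω) := h.integrableOn_hess.sub
      (memLp_finsetSum _ fun i _ => h.memLp_hess i i).integrable_sq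
    obtain ⟨C, hC⟩ := hφc.bounded_above_of_compact_support hφs
    exact this.bdd_mul hφc.aestronglyMeasurable (ae_of_all _ hC)
  have iR : ∀ a, IntegrableOn (fun x => M * (3 * ε⁻¹ * ∑ i, Du x (a, i) ^ 2 +
      2 * ε * ∑ i, ∑ j, D2u x (a, i, j) ^ 2)) Ω := fun a =>
    (((integrable_finsetSum _ fun i _ => ((hu.isScalarH2 a).memLp_grad i).integrable_sq).const_mul
      _).add ((hu.isScalarH2 a).integrableOn_hess.const_mul _)).const_mul _
  have e1 : ∫ x in Ω, φ x * (‖D2u x‖ ^ 2 - ‖lap (D2u x)‖ ^ 2) =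
      ∑ a, ∫ x in Ω, φ x * (∑ i, ∑ j, D2u x (a, i, j) ^ 2 - (∑ i, D2u x (a, i, i)) ^ 2) := by
    rw [← integral_finsetSum _ fun a _ => iL a]
    simp_rw [← Finset.mul_sum, Finset.sum_sub_distrib, norm_sq_tens, norm_sq_lap]
  have e2 : ∑ a, ∫ x in Ω, M * (3 * ε⁻¹ * ∑ i, Du x (a, i) ^ 2 +
      2 * ε * ∑ i, ∑ j, D2u x (a, i, j) ^ 2) =
      M * (3 * ε⁻¹ * (∫ x in Ω, ‖Du x‖ ^ 2) + 2 * ε * ∫ x in Ω, ‖D2u x‖ ^ 2) := by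
    rw [← integral_finsetSum _ fun a _ => iR a]
    simp_rw [← Finset.mul_sum, Finset.sum_add_distrib, ← Finset.mul_sum, ← norm_sq_tens,
      ← norm_sq_mat]
    have i3 : IntegrableOn (fun x => ‖Du x‖ ^ 2) Ω := hu.memLp_grad.norm.integrable_sq
    have i1 : IntegrableOn (fun x => ‖D2u x‖ ^ 2) Ω := hu.memLp_hess.norm.integrable_sq
    rw [integral_const_mul, integral_add (i3.const_mul _) (i1.const_mul _), integral_const_mul,
      integral_const_mul]
  rw [e1, ← e2]
  exact (Finset.abs_sum_le_sum_abs _ _).trans key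

/-! ### Weak limits of bounded sequences of measures -/

/-- Sequential weak compactness of bounded sequences of measures on a compact set. -/
lemma exists_subseq_tendsto_integral {X : Type*} [MetricSpace X] [SecondCountableTopology X]
    [MeasurableSpace X] [BorelSpace X] {K : Set X} (hK : IsCompact K) (hne : K.Nonempty) {C : ℝ}
    (m : ℕ → Measure X) (hm : ∀ n, m n univ ≤ ENNReal.ofReal C) (hmK : ∀ n, m n Kᶜ = 0) :
    ∃ (σ : ℕ → ℕ) (m' : Measure X), StrictMono σ ∧ IsFiniteMeasure m' ∧ m' Kᶜ = 0 ∧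
      ∀ f : BoundedContinuousFunction X ℝ,
        Tendsto (fun n => ∫ x, f x ∂(m (σ n))) atTop (𝓝 (∫ x, f x ∂m')) := by
  obtain ⟨x₀, hx₀⟩ := hne
  -- every measure is a multiple of a probability measure carried by `K`
  have hdec : ∀ n, ∃ p : ProbabilityMeasure X, (p : Measure X) Kᶜ = 0 ∧
      m n = m n univ • (p : Measure X) := by
    intro n
    by_cases h0 : m n = 0
    · exact ⟨⟨Measure.dirac x₀, inferInstance⟩, by
        change Measure.dirac x₀ Kᶜ = 0
        rw [Measure.dirac_apply' _ hK.measurableSet.compl]; simp [hx₀], by simp [h0]⟩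
    · have hf : m n univ ≠ ⊤ := ((hm n).trans_lt ENNReal.ofReal_lt_top).ne
      have hz : m n univ ≠ 0 := by simpa using h0
      refine ⟨⟨(m n univ)⁻¹ • m n, ⟨?_⟩⟩, ?_, ?_⟩
      · simp [ENNReal.inv_mul_cancel hz hf]
      · change ((m n univ)⁻¹ • m n) Kᶜ = 0
        simp [hmK n]
      · change m n = m n univ • ((m n univ)⁻¹ • m n)
        rw [smul_smul, ENNReal.mul_inv_cancel hz hf, one_smul]
  choose p hpK hp using hdec
  set S : Set (ProbabilityMeasure X) := {μ | ∀ _ : ℕ, μ Kᶜ ≤ 0} with hS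
  have hSc : IsCompact S := isCompact_setOfPred_probabilityMeasure_mass_eq_compl_isCompact_le
    (u := fun _ => 0) (K := fun _ => K) tendsto_const_nhds (fun _ => hK) (Or.inl inferInstance)
  obtain ⟨⟨a, q⟩, ⟨ha, hq⟩, σ, hσ, hlim⟩ := ((isCompact_Icc (a := (0 : ℝ)) (b := max C 0)).prod
    hSc).tendsto_subseq (x := fun n => ((m n univ).toReal, p n)) (fun n => by
      refine ⟨⟨ENNReal.toReal_nonneg, ?_⟩, fun _ => ?_⟩
      · refine (ENNReal.toReal_mono ENNReal.ofReal_ne_top (hm n)).trans ?_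
        rw [ENNReal.toReal_ofReal']
      · simp only [nonpos_iff_eq_zero]
        rw [ProbabilityMeasure.null_iff_toMeasure_null]; exact hpK n)
  have hl1 : Tendsto (fun n => (m (σ n) univ).toReal) atTop (𝓝 a) :=
    (continuous_fst.tendsto _).comp hlim
  have hl2 : Tendsto (fun n => p (σ n)) atTop (𝓝 q) := (continuous_snd.tendsto _).comp hlim
  refine ⟨σ, ENNReal.ofReal a • (q : Measure X), hσ, ⟨?_⟩, ?_, fun f => ?_⟩
  · simp
  · have h0 : (q : Measure X) Kᶜ = 0 := by
      rw [← ProbabilityMeasure.null_iff_toMeasure_null]; exact nonpos_iff_eq_zero.1 (hq 0)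
    simp [h0]
  · have e : ∀ n, ∫ x, f x ∂(m n) = (m n univ).toReal * ∫ x, f x ∂(p n : Measure X) := by
      intro n
      conv_lhs => rw [hp n]
      rw [integral_smul_measure, smul_eq_mul]
    simp_rw [e]
    rw [integral_smul_measure, ENNReal.toReal_ofReal ha.1, smul_eq_mul]
    exact hl1.mul (ProbabilityMeasure.tendsto_iff_forall_integral_tendsto.1 hl2 f)

/-- Bounded continuous functions detect the order of finite measures: indicators of closed sets are
limits of such functions, and finite Borel measures are inner regular for closed sets. -/
lemma measure_le_of_forall_lintegral_le {X : Type*} [MetricSpace X] [MeasurableSpace X]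
    [BorelSpace X] {α β : Measure X} [IsFiniteMeasure α] [IsFiniteMeasure β]
    (h : ∀ f : BoundedContinuousFunction X ℝ≥0, ∫⁻ x, f x ∂α ≤ ∫⁻ x, f x ∂β) : α ≤ β := by
  have hF : ∀ F : Set X, IsClosed F → α F ≤ β F := by
    intro F hF
    have hpos : ∀ n : ℕ, (0 : ℝ) < 1 / ((n : ℝ) + 1) := fun n => Nat.one_div_pos_of_nat
    have l1 := tendsto_lintegral_thickenedIndicator_of_isClosed α hF hpos
      tendsto_one_div_add_atTop_nhds_zero_nat
    have l2 := tendsto_lintegral_thickenedIndicator_of_isClosed β hF hpos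
      tendsto_one_div_add_atTop_nhds_zero_nat
    exact le_of_tendsto_of_tendsto' l1 l2 fun n => h _
  refine Measure.le_iff.2 fun B hB => ?_
  rw [hB.measure_eq_iSup_isClosed_of_ne_top (measure_ne_top α B)]
  exact iSup₂_le fun F hFB => iSup_le fun hFc => (hF F hFc).trans (measure_mono hFB)

/-! ### Disintegration of the limit measure -/

/-- A measure on `(ℝ × Vec) × TensSphere` whose time marginal has a bounded density disintegrates
into a defect measure. -/
lemma exists_isDefectMeasure {T : ℝ} {Ω : Set Vec} {C : ℝ≥0} (m : Measure ((ℝ × Vec) × TensSphere))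
    [IsFiniteMeasure m] (hm : m {p | p.1.2 ∉ closure Ω} = 0)
    (hmT : m.fst.fst ≤ (C : ℝ≥0∞) • volume.restrict (Ioo 0 T)) :
    ∃ (μ : Kernel ℝ Vec) (ν : Kernel (Vec × ℝ) TensSphere), IsDefectMeasure T Ω μ ν ∧
      ∀ f : BoundedContinuousFunction ((ℝ × Vec) × TensSphere) ℝ, ∫ p, f p ∂m =
        ∫ t in Ioo 0 T, ∫ x in closure Ω, ∫ Γ : TensSphere, f ((t, x), Γ) ∂(ν (x, t)) ∂(μ t) := by
  have : Nonempty TensSphere := ⟨⟨EuclideanSpace.single (0, 0, 0) 1, by simp⟩⟩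
  set P : Measure (ℝ × Vec) := m.fst with hP
  set l : Measure ℝ := volume.restrict (Ioo 0 T) with hl
  have hcl : MeasurableSet (closure Ω) := isClosed_closure.measurableSet
  have hac : P.fst ≪ l := (Measure.absolutelyContinuous_of_le hmT).trans
    Measure.smul_absolutelyContinuous
  -- the density is truncated so that the bound holds at every `t`, as a kernel requires
  set h : ℝ → ℝ≥0∞ := fun t => min (P.fst.rnDeriv l t) C with hh
  have hmeas : Measurable h := (Measure.measurable_rnDeriv _ _).min measurable_const
  have hC : ∀ᵐ t ∂l, P.fst.rnDeriv l t ≤ C := by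
    refine ae_le_of_forall_setLIntegral_le_of_sigmaFinite (Measure.measurable_rnDeriv _ _)
      fun s hs _ => ?_
    calc ∫⁻ t in s, P.fst.rnDeriv l t ∂l ≤ P.fst s := Measure.setLIntegral_rnDeriv_le s
      _ ≤ ((C : ℝ≥0∞) • l) s := hmT s
      _ = ∫⁻ _ in s, (C : ℝ≥0∞) ∂l := by simp
  have hPd : P.fst = l.withDensity h := by
    rw [← Measure.withDensity_rnDeriv_eq _ _ hac]
    refine withDensity_congr_ae ?_
    filter_upwards [hC] with t ht
    exact (min_eq_left ht).symm
  let κ : Kernel ℝ Vec := P.condKernel.restrict hcl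
  let μ : Kernel ℝ Vec := κ.withDensity fun t _ => h t
  have hμ : ∀ t, μ t = h t • (P.condKernel t).restrict (closure Ω) := by
    intro t
    rw [Kernel.withDensity_apply _ (by fun_prop), Kernel.restrict_apply, withDensity_const]
  have hhC : ∀ t, h t ≤ C := fun t => min_le_right _ _
  have hmass : ∀ t, μ t univ ≤ C := by
    intro t
    rw [hμ]
    simp only [Measure.smul_apply, smul_eq_mul]
    calc h t * ((P.condKernel t).restrict (closure Ω)) univ ≤ C * 1 := by
          gcongr
          · exact hhC t
          · simpa using prob_le_one
      _ = C := mul_one _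
  refine ⟨μ, m.condKernel.comap Prod.swap measurable_swap, ⟨fun t => ⟨(hmass t).trans_lt
    ENNReal.coe_lt_top⟩, fun t => ?_, ?_, inferInstance⟩, fun f => ?_⟩
  · rw [hμ]
    simp [Measure.restrict_apply hcl.compl]
  · refine (essSup_le_of_ae_le (C : ℝ≥0∞) (ae_of_all _ fun t => ?_)).trans_lt ENNReal.coe_lt_top
    exact (measure_mono (subset_univ _)).trans (hmass t)
  · have hfi : Integrable f m := f.integrable m
    set G : ℝ × Vec → ℝ := fun p => ∫ Γ, f (p, Γ) ∂(m.condKernel p) with hG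
    have h1 : ∫ p, f p ∂m = ∫ p, G p ∂P := (Measure.integral_condKernel hfi).symm
    have hGi : Integrable G P := by
      have := hfi
      rw [← m.disintegrate m.condKernel] at this
      exact Integrable.integral_compProd this
    have h2 : ∫ p, G p ∂P = ∫ p in univ ×ˢ closure Ω, G p ∂P := by
      rw [Measure.restrict_eq_self_of_ae_mem]
      have h0 : P {p | p.2 ∉ closure Ω} = 0 := by
        have hms : MeasurableSet {p : ℝ × Vec | p.2 ∉ closure Ω} := hcl.compl.preimage measurable_snd
        rw [hP, Measure.fst_apply hms]
        exact hm
      filter_upwards [measure_eq_zero_iff_ae_notMem.1 h0] with p hp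
      exact ⟨mem_univ _, not_not.1 hp⟩
    have h3 : ∫ p in univ ×ˢ closure Ω, G p ∂P =
        ∫ t, ∫ x in closure Ω, G (t, x) ∂(P.condKernel t) ∂P.fst :=
      (Measure.setIntegral_condKernel_univ_left hcl hGi.integrableOn).symm
    rw [h1, h2, h3]
    conv_lhs => rw [hPd]
    rw [integral_withDensity_eq_integral_toReal_smul hmeas
      (ae_of_all _ fun t => (hhC t).trans_lt ENNReal.coe_lt_top)]
    refine integral_congr_ae (ae_of_all _ fun t => ?_)
    simp only [hμ, Measure.restrict_smul, Measure.restrict_restrict hcl, inter_self,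
      integral_smul_measure]
    rfl

/-! ### The measures carried by the second gradients -/

/-- The direction `Γ/|Γ|` of a tensor, with an arbitrary value at `Γ = 0`. -/
noncomputable def direction (Γ : Tens) : TensSphere :=
  ⟨open Classical in if Γ = 0 then EuclideanSpace.single (0, 0, 0) 1 else ‖Γ‖⁻¹ • Γ, by
    split_ifs with h
    · simp
    · simp [norm_smul, h]⟩

lemma direction_of_ne_zero {Γ : Tens} (h : Γ ≠ 0) : (direction Γ : Tens) = ‖Γ‖⁻¹ • Γ := by
  simp [direction, h]

lemma measurable_direction : Measurable direction := by
  refine Measurable.subtype_mk ?_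
  exact Measurable.ite (measurableSet_singleton 0) measurable_const
    (measurable_norm.inv.smul measurable_id)

/-- Lebesgue measure on `(0,T) × Ω`. -/
noncomputable abbrev spaceTime (T : ℝ) (Ω : Set Vec) : Measure (ℝ × Vec) :=
  (volume.restrict (Ioo 0 T)).prod (volume.restrict Ω)

/-- The image of the measure `δ |A|² dx dt` under `(t, x) ↦ ((t, x), A / |A|)`. -/
noncomputable def directionMeasure (T : ℝ) (Ω : Set Vec) (δ : ℝ) (A : ℝ → Vec → Tens) :
    Measure ((ℝ × Vec) × TensSphere) :=
  ((spaceTime T Ω).withDensity fun p => ENNReal.ofReal (δ * ‖A p.1 p.2‖ ^ 2)).map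
    fun p => (p, direction (A p.1 p.2))

section directionMeasure

variable {T : ℝ} {Ω : Set Vec} {δ : ℝ} {A : ℝ → Vec → Tens}

lemma aemeasurable_density (hA : AEStronglyMeasurable (fun p : ℝ × Vec => A p.1 p.2) (spaceTime T Ω)) :
    AEMeasurable (fun p : ℝ × Vec => ENNReal.ofReal (δ * ‖A p.1 p.2‖ ^ 2)) (spaceTime T Ω) :=
  ((hA.norm.aemeasurable.pow_const 2).const_mul δ).ennreal_ofReal

lemma aemeasurable_graph (hA : AEStronglyMeasurable (fun p : ℝ × Vec => A p.1 p.2) (spaceTime T Ω)) :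
    AEMeasurable (fun p : ℝ × Vec => (p, direction (A p.1 p.2)))
      ((spaceTime T Ω).withDensity fun p => ENNReal.ofReal (δ * ‖A p.1 p.2‖ ^ 2)) :=
  aemeasurable_id.prodMk ((measurable_direction.comp_aemeasurable hA.aemeasurable).mono_ac
    (withDensity_absolutelyContinuous _ _))

lemma lintegral_directionMeasure
    (hA : AEStronglyMeasurable (fun p : ℝ × Vec => A p.1 p.2) (spaceTime T Ω)) {g : ℝ → ℝ≥0∞}
    (hg : Measurable g) :
    ∫⁻ p, g p.1.1 ∂(directionMeasure T Ω δ A) =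
      ∫⁻ t in Ioo 0 T, g t * ∫⁻ x in Ω, ENNReal.ofReal (δ * ‖A t x‖ ^ 2) := by
  have hgm : Measurable fun p : (ℝ × Vec) × TensSphere => g p.1.1 := by fun_prop
  rw [directionMeasure, lintegral_map' hgm.aemeasurable (aemeasurable_graph hA)]
  change ∫⁻ p : ℝ × Vec, (g ∘ Prod.fst) p ∂_ = _
  rw [lintegral_withDensity_eq_lintegral_mul₀ (aemeasurable_density (δ := δ) hA)
      (hg.comp measurable_fst).aemeasurable,
    lintegral_prod _ ((aemeasurable_density (δ := δ) hA).mul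
      (hg.comp measurable_fst).aemeasurable)]
  refine lintegral_congr_ae ?_
  have hs : ∀ᵐ t ∂(volume.restrict (Ioo 0 T)), AEMeasurable
      (fun x => ENNReal.ofReal (δ * ‖A t x‖ ^ 2)) (volume.restrict Ω) := by
    filter_upwards [hA.prodMk_left] with t ht
    exact ((ht.norm.aemeasurable.pow_const 2).const_mul δ).ennreal_ofReal
  filter_upwards [hs] with t ht
  simp only [Pi.mul_apply, Function.comp_apply]
  rw [lintegral_mul_const'' _ ht, mul_comm]

lemma integrable_density (hA : MemLp (fun p : ℝ × Vec => A p.1 p.2) 2 (spaceTime T Ω)) :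
    Integrable (fun p : ℝ × Vec => δ * ‖A p.1 p.2‖ ^ 2) (spaceTime T Ω) :=
  hA.norm.integrable_sq.const_mul δ

lemma integral_directionMeasure (hδ : 0 ≤ δ)
    (hA : MemLp (fun p : ℝ × Vec => A p.1 p.2) 2 (spaceTime T Ω))
    (F : BoundedContinuousFunction ((ℝ × Vec) × TensSphere) ℝ) :
    ∫ p, F p ∂(directionMeasure T Ω δ A) =
      ∫ t in Ioo 0 T, ∫ x in Ω, F ((t, x), direction (A t x)) * (δ * ‖A t x‖ ^ 2) := by
  have hFm : AEStronglyMeasurable (fun p : ℝ × Vec => F (p, direction (A p.1 p.2)))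
      (spaceTime T Ω) :=
    (F.continuous.measurable.comp_aemeasurable (aemeasurable_id.prodMk
      (measurable_direction.comp_aemeasurable hA.1.aemeasurable))).aestronglyMeasurable
  rw [directionMeasure, integral_map (aemeasurable_graph hA.1)
    F.continuous.measurable.aestronglyMeasurable,
    integral_withDensity_eq_integral_toReal_smul₀ (aemeasurable_density hA.1)
      (ae_of_all _ fun p => ENNReal.ofReal_lt_top)]
  have e : ∀ p : ℝ × Vec, (ENNReal.ofReal (δ * ‖A p.1 p.2‖ ^ 2)).toReal •
      F (p, direction (A p.1 p.2)) = F (p, direction (A p.1 p.2)) * (δ * ‖A p.1 p.2‖ ^ 2) := by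
    intro p
    rw [ENNReal.toReal_ofReal (by positivity), smul_eq_mul, mul_comm]
  simp_rw [e]
  exact integral_prod _ ((integrable_density hA).bdd_mul hFm
    (ae_of_all _ fun p => F.norm_coe_le_norm _))

lemma directionMeasure_compl (hΩ : MeasurableSet Ω)
    (hA : AEStronglyMeasurable (fun p : ℝ × Vec => A p.1 p.2) (spaceTime T Ω)) :
    directionMeasure T Ω δ A ((Icc 0 T ×ˢ closure Ω) ×ˢ (univ : Set TensSphere))ᶜ = 0 := by
  have hms : MeasurableSet ((Icc 0 T ×ˢ closure Ω) ×ˢ (univ : Set TensSphere)) :=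
    (measurableSet_Icc.prod isClosed_closure.measurableSet).prod MeasurableSet.univ
  rw [directionMeasure, Measure.map_apply_of_aemeasurable (aemeasurable_graph hA) hms.compl]
  refine withDensity_absolutelyContinuous _ _ ?_
  rw [measure_eq_zero_iff_ae_notMem, spaceTime, Measure.prod_restrict,
    ae_restrict_iff' (measurableSet_Ioo.prod hΩ)]
  refine ae_of_all _ fun p hp hn => hn ?_
  exact ⟨⟨Ioo_subset_Icc_self hp.1, subset_closure hp.2⟩, mem_univ _⟩

end directionMeasure

/-- Compactness: if `δ n ‖A n‖²` is bounded in `L^∞(0,T; L¹(Ω))` then a subsequence of the measures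
`δ n |A n|² dx dt`, with the directions of `A n`, converges to a defect measure. -/
theorem exists_subseq_isDefectMeasure {T : ℝ} (hT : 0 < T) {Ω : Set Vec} (hΩ : MeasurableSet Ω)
    (hne : Ω.Nonempty) (hb : Bornology.IsBounded Ω) {C : ℝ≥0} (δ : ℕ → ℝ) (hδ : ∀ n, 0 ≤ δ n)
    (A : ℕ → ℝ → Vec → Tens)
    (hA : ∀ n, MemLp (fun p : ℝ × Vec => A n p.1 p.2) 2 (spaceTime T Ω))
    (hC : ∀ n, ∀ᵐ t ∂(volume.restrict (Ioo 0 T)),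
      ∫⁻ x in Ω, ENNReal.ofReal (δ n * ‖A n t x‖ ^ 2) ≤ C) :
    ∃ (σ : ℕ → ℕ) (μ : Kernel ℝ Vec) (ν : Kernel (Vec × ℝ) TensSphere), StrictMono σ ∧
      IsDefectMeasure T Ω μ ν ∧
      ∀ f : Vec → ℝ → Tens → ℝ,
        ContinuousOn (fun p : Vec × ℝ × Tens => f p.1 p.2.1 p.2.2)
          (closure Ω ×ˢ Icc 0 T ×ˢ Metric.sphere (0 : Tens) 1) →
        Tendsto (fun k => ∫ t in Ioo 0 T, ∫ x in Ω,
            f x t (‖A (σ k) t x‖⁻¹ • A (σ k) t x) * (δ (σ k) * ‖A (σ k) t x‖ ^ 2))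
          atTop
          (𝓝 (∫ t in Ioo 0 T, ∫ x in closure Ω, ∫ Γ : TensSphere, f x t Γ ∂(ν (x, t)) ∂(μ t))) := by
  set K : Set ((ℝ × Vec) × TensSphere) := (Icc 0 T ×ˢ closure Ω) ×ˢ univ with hK
  have hKc : IsCompact K := (isCompact_Icc.prod hb.isCompact_closure).prod isCompact_univ
  have hKne : K.Nonempty := by
    obtain ⟨x, hx⟩ := hne
    exact ⟨((0, x), direction 0), ⟨⟨left_mem_Icc.2 hT.le, subset_closure hx⟩, mem_univ _⟩⟩
  have hbound : ∀ n (g : ℝ → ℝ≥0∞), Measurable g →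
      ∫⁻ p, g p.1.1 ∂(directionMeasure T Ω (δ n) (A n)) ≤ C * ∫⁻ t in Ioo 0 T, g t := by
    intro n g hg
    rw [lintegral_directionMeasure (hA n).1 hg, ← lintegral_const_mul _ hg]
    refine lintegral_mono_ae ?_
    filter_upwards [hC n] with t ht
    rw [mul_comm]
    gcongr
  have hmass : ∀ n, directionMeasure T Ω (δ n) (A n) univ ≤ ENNReal.ofReal (C * T) := by
    intro n
    have := hbound n (fun _ => 1) measurable_const
    simp only [lintegral_const, one_mul, Measure.restrict_apply MeasurableSet.univ, univ_inter,
      Real.volume_Ioo, sub_zero] at this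
    rwa [ENNReal.ofReal_mul C.coe_nonneg, ENNReal.ofReal_coe_nnreal]
  obtain ⟨σ, m, hσ, hmf, hmK, hlim⟩ := exists_subseq_tendsto_integral hKc hKne
    (fun n => directionMeasure T Ω (δ n) (A n)) hmass
    (fun n => directionMeasure_compl hΩ (hA n).1)
  have hfin : ∀ n, IsFiniteMeasure (directionMeasure T Ω (δ n) (A n)) := fun n =>
    ⟨(hmass n).trans_lt ENNReal.ofReal_lt_top⟩
  -- the time marginal of the limit inherits the bound on the densities in time
  have hmT : m.fst.fst ≤ (C : ℝ≥0∞) • volume.restrict (Ioo 0 T) := by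
    have : IsFiniteMeasure ((C : ℝ≥0∞) • volume.restrict (Ioo 0 T)) :=
      Measure.smul_finite _ ENNReal.coe_ne_top
    refine measure_le_of_forall_lintegral_le fun g => ?_
    have hgm : Measurable fun t => (g t : ℝ≥0∞) := g.continuous.measurable.coe_nnreal_ennreal
    rw [lintegral_smul_measure, Measure.fst, lintegral_map hgm measurable_fst, Measure.fst,
      lintegral_map (by fun_prop) measurable_fst, smul_eq_mul]
    let G : BoundedContinuousFunction ((ℝ × Vec) × TensSphere) ℝ :=
      BoundedContinuousFunction.ofNormedAddCommGroup (fun p => (g p.1.1 : ℝ)) (by fun_prop)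
        (nndist g 0) fun p => by
          have := g.nndist_coe_le_nndist (g := 0) (x := p.1.1)
          simpa using! this
    have hGe : ∀ ρ : Measure ((ℝ × Vec) × TensSphere), IsFiniteMeasure ρ →
        ∫⁻ p, (g p.1.1 : ℝ≥0∞) ∂ρ = ENNReal.ofReal (∫ p, G p ∂ρ) := by
      intro ρ _
      rw [ofReal_integral_eq_lintegral_ofReal (G.integrable ρ)
        (ae_of_all _ fun p => (g p.1.1).coe_nonneg)]
      refine lintegral_congr fun p => ?_
      exact (ENNReal.ofReal_coe_nnreal).symm
    rw [hGe m hmf]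
    refine le_of_tendsto ((ENNReal.continuous_ofReal.tendsto _).comp (hlim G))
      (Eventually.of_forall fun n => ?_)
    simp only [Function.comp_apply]
    rw [← hGe _ (hfin _)]
    exact hbound (σ n) _ hgm
  obtain ⟨μ, ν, hμν, hdis⟩ := exists_isDefectMeasure (Ω := Ω) m
    (measure_mono_null (fun p (hp : p.1.2 ∉ closure Ω) (hpK : p ∈ K) => hp hpK.1.2) hmK) hmT
  refine ⟨σ, μ, ν, hσ, hμν, fun f hf => ?_⟩
  have hcont : ContinuousOn (fun p : (ℝ × Vec) × TensSphere => f p.1.2 p.1.1 p.2) K := by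
    refine hf.comp (f := fun p : (ℝ × Vec) × TensSphere => (p.1.2, p.1.1, (p.2 : Tens)))
      (by fun_prop) fun p hp => ⟨hp.1.2, hp.1.1, p.2.2⟩
  have : CompactSpace K := isCompact_iff_compactSpace.1 hKc
  -- `f` is given on a compact set only; the limit is tested with a bounded continuous extension
  obtain ⟨F, -, hF⟩ := BoundedContinuousFunction.exists_norm_eq_domRestrict_eq_of_closed
    (BoundedContinuousFunction.mkOfCompact
      (⟨_, continuousOn_iff_continuous_domRestrict.1 hcont⟩ : C(K, ℝ))) hKc.isClosed
  have hFf : ∀ t x (Γ : TensSphere), t ∈ Ioo 0 T → x ∈ closure Ω → F ((t, x), Γ) = f x t Γ := by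
    intro t x Γ ht hx
    have := DFunLike.congr_fun hF ⟨((t, x), Γ), ⟨⟨Ioo_subset_Icc_self ht, hx⟩, mem_univ _⟩⟩
    simpa using! this
  have h1 := hlim F
  rw [hdis] at h1
  refine (h1.congr fun n => ?_).trans_eq ?_
  · rw [integral_directionMeasure (hδ _) (hA _)]
    refine setIntegral_congr_fun measurableSet_Ioo fun t ht => ?_
    refine setIntegral_congr_fun hΩ fun x hx => ?_
    -- where `A` vanishes the direction is arbitrary, but the density is zero
    by_cases h0 : A (σ n) t x = 0
    · simp [h0]
    · rw [hFf t x _ ht (subset_closure hx), direction_of_ne_zero h0]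
  · congr 1
    refine setIntegral_congr_fun measurableSet_Ioo fun t ht => ?_
    refine setIntegral_congr_fun isClosed_closure.measurableSet fun x hx => ?_
    exact integral_congr_ae (ae_of_all _ fun Γ => hFf t x Γ ht hx)

/-! ### Uniform bounds and comparison with the Laplacian -/

lemma sqNormL2_eq_ofReal {F : Type*} [NormedAddCommGroup F] {Ω : Set Vec} {u : Vec → F}
    (hu : MemLp u 2 (volume.restrict Ω)) :
    sqNormL2 Ω u = ENNReal.ofReal (∫ x in Ω, ‖u x‖ ^ 2) := by
  rw [sqNormL2, ofReal_integral_eq_lintegral_ofReal hu.norm.integrable_sq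
    (ae_of_all _ fun x => by positivity)]
  refine lintegral_congr fun x => ?_
  rw [ENNReal.ofReal_pow (norm_nonneg _), ofReal_norm]

lemma ae_memLp_two_prodMk_left {α β F : Type*} [MeasurableSpace α] [MeasurableSpace β]
    [NormedAddCommGroup F] {μ : Measure α} {ν : Measure β} [SFinite μ] [SFinite ν]
    {f : α × β → F} (hf : MemLp f 2 (μ.prod ν)) : ∀ᵐ a ∂μ, MemLp (fun b => f (a, b)) 2 ν := by
  filter_upwards [hf.1.prodMk_left, hf.norm.integrable_sq.prod_right_ae] with a h1 h2
  exact (memLp_two_iff_integrable_sq_norm h1).2 h2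

lemma IsL2H2.ae_isH2 {T : ℝ} {Ω : Set Vec} {u : ℝ → Vec → Vec} {Du : ℝ → Vec → Mat}
    {D2u : ℝ → Vec → Tens} (h : IsL2H2 T Ω u Du D2u) :
    ∀ᵐ t ∂(volume.restrict (Ioo 0 T)), IsH2 Ω (u t) (Du t) (D2u t) := by
  filter_upwards [h.derivs, ae_memLp_two_prodMk_left h.memLp,
    ae_memLp_two_prodMk_left h.memLp_grad, ae_memLp_two_prodMk_left h.memLp_hess]
    with t h1 h2 h3 h4
  exact ⟨h1, h2, h3, h4⟩

/-- The bound on the Laplacians and on the `H¹` norms controls the full second gradients, because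
the boundary values are fixed. -/
lemma exists_uniform_bound {T : ℝ} {Ω : Set Vec} (hΩ : IsBoundedC31Domain Ω)
    {g : Vec → Vec} {Dg : Vec → Mat} {D2g : Vec → Tens} (hg : IsH2 Ω g Dg D2g)
    {d : ℝ → ℝ → Vec → Vec} {Dd : ℝ → ℝ → Vec → Mat} {D2d : ℝ → ℝ → Vec → Tens}
    (hd : ∀ δ ∈ Ioo (0 : ℝ) 1, IsL2H2 T Ω (d δ) (Dd δ) (D2d δ))
    (hbdry : ∀ δ ∈ Ioo (0 : ℝ) 1, ∀ᵐ t ∂(volume.restrict (Ioo 0 T)),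
      IsH10 Ω (d δ t - g) (Dd δ t - Dg))
    (hbound : ⨆ δ ∈ Ioo (0 : ℝ) 1,
      (ENNReal.ofReal δ * essSupTime T (fun t => sqNormL2 Ω fun x => lap (D2d δ t x)) +
        essSupTime T (fun t => sqNormL2 Ω (d δ t) + sqNormL2 Ω (Dd δ t))) < ⊤) :
    ∃ C : ℝ, 0 ≤ C ∧ ∀ δ ∈ Ioo (0 : ℝ) 1, ∀ᵐ t ∂(volume.restrict (Ioo 0 T)),
      (∫ x in Ω, ‖Dd δ t x‖ ^ 2) ≤ C ∧ δ * (∫ x in Ω, ‖D2d δ t x‖ ^ 2) ≤ C := by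
  obtain ⟨C₀, hC₀, hell⟩ := exists_integral_norm_sq_hess_le hΩ
  set S : ℝ≥0∞ := ⨆ δ ∈ Ioo (0 : ℝ) 1,
      (ENNReal.ofReal δ * essSupTime T (fun t => sqNormL2 Ω fun x => lap (D2d δ t x)) +
        essSupTime T (fun t => sqNormL2 Ω (d δ t) + sqNormL2 Ω (Dd δ t))) with hS
  have hS0 : 0 ≤ S.toReal := ENNReal.toReal_nonneg
  have hG : 0 ≤ (∫ x in Ω, ‖D2g x‖ ^ 2) + ∫ x in Ω, ‖Dg x‖ ^ 2 :=
    add_nonneg (integral_nonneg fun x => by positivity) (integral_nonneg fun x => by positivity)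
  set G := (∫ x in Ω, ‖D2g x‖ ^ 2) + ∫ x in Ω, ‖Dg x‖ ^ 2
  have hR : 0 ≤ C₀ * (S.toReal + S.toReal + G) := by positivity
  refine ⟨S.toReal + C₀ * (S.toReal + S.toReal + G), by positivity, fun δ hδ => ?_⟩
  have hle : ENNReal.ofReal δ * essSupTime T (fun t => sqNormL2 Ω fun x => lap (D2d δ t x)) +
        essSupTime T (fun t => sqNormL2 Ω (d δ t) + sqNormL2 Ω (Dd δ t)) ≤ S :=
    le_iSup₂ (f := fun δ (_ : δ ∈ Ioo (0 : ℝ) 1) =>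
      ENNReal.ofReal δ * essSupTime T (fun t => sqNormL2 Ω fun x => lap (D2d δ t x)) +
        essSupTime T (fun t => sqNormL2 Ω (d δ t) + sqNormL2 Ω (Dd δ t))) δ hδ
  filter_upwards [(hd δ hδ).ae_isH2, hbdry δ hδ,
    ENNReal.ae_le_essSup (μ := volume.restrict (Ioo 0 T))
      (fun t => sqNormL2 Ω fun x => lap (D2d δ t x)),
    ENNReal.ae_le_essSup (μ := volume.restrict (Ioo 0 T))
      (fun t => sqNormL2 Ω (d δ t) + sqNormL2 Ω (Dd δ t))] with t ht hb h1 h2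
  have h3 : (∫ x in Ω, ‖Dd δ t x‖ ^ 2) ≤ S.toReal := by
    refine (ENNReal.ofReal_le_iff_le_toReal hbound.ne).1 ?_
    rw [← sqNormL2_eq_ofReal ht.memLp_grad]
    exact le_add_self.trans (h2.trans (le_add_self.trans hle))
  have h4 : δ * (∫ x in Ω, ‖lap (D2d δ t x)‖ ^ 2) ≤ S.toReal := by
    refine (ENNReal.ofReal_le_iff_le_toReal hbound.ne).1 ?_
    rw [ENNReal.ofReal_mul hδ.1.le, ← sqNormL2_eq_ofReal (memLp_lap ht.memLp_hess)]
    exact (mul_le_mul_right h1 _).trans (le_self_add.trans hle)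
  refine ⟨h3.trans (by linarith), ?_⟩
  have h5 : ∀ r : ℝ, 0 ≤ r → δ * r ≤ r := fun r hr => mul_le_of_le_one_left hr hδ.2.le
  have hDd : 0 ≤ ∫ x in Ω, ‖Dd δ t x‖ ^ 2 := integral_nonneg fun x => by positivity
  calc δ * (∫ x in Ω, ‖D2d δ t x‖ ^ 2)
      ≤ δ * (C₀ * ((∫ x in Ω, ‖lap (D2d δ t x)‖ ^ 2) + (∫ x in Ω, ‖Dd δ t x‖ ^ 2) + G)) :=
        mul_le_mul_of_nonneg_left (hell _ _ _ _ _ _ ht hg hb) hδ.1.le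
    _ = C₀ * (δ * (∫ x in Ω, ‖lap (D2d δ t x)‖ ^ 2) + δ * (∫ x in Ω, ‖Dd δ t x‖ ^ 2) + δ * G) := by
        ring
    _ ≤ C₀ * (S.toReal + S.toReal + G) := by
        refine mul_le_mul_of_nonneg_left ?_ hC₀
        exact add_le_add (add_le_add h4 ((h5 _ hDd).trans h3)) (h5 _ hG)
    _ ≤ _ := by linarith

/-- Tested against `ψ(t) φ(x)`, the measures `δ |∇²u|²` and `δ |Δu|²` differ by `O(√δ)`. -/
lemma abs_integral_hess_sub_integral_lap_le {T : ℝ} (hT : 0 < T) {Ω : Set Vec} (hΩ : IsOpen Ω)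
    {u : ℝ → Vec → Vec} {Du : ℝ → Vec → Mat} {D2u : ℝ → Vec → Tens} (hu : IsL2H2 T Ω u Du D2u)
    {δ C : ℝ} (hδ : 0 < δ)
    (hC : ∀ᵐ t ∂(volume.restrict (Ioo 0 T)),
      (∫ x in Ω, ‖Du t x‖ ^ 2) ≤ C ∧ δ * (∫ x in Ω, ‖D2u t x‖ ^ 2) ≤ C)
    {ψ : ℝ → ℝ} {φ : Vec → ℝ} {B M : ℝ} (hψ : ContinuousOn ψ (Icc 0 T)) (hφ : IsTestFunction Ω φ)
    (hB : ∀ t ∈ Icc 0 T, |ψ t| ≤ B) (hM0 : 0 ≤ M) (hM : ∀ i x, |pderiv i φ x| ≤ M) :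
    |(∫ t in Ioo 0 T, ∫ x in Ω, ψ t * φ x * (δ * ‖D2u t x‖ ^ 2)) -
      ∫ t in Ioo 0 T, ∫ x in Ω, ψ t * φ x * (δ * ‖lap (D2u t x)‖ ^ 2)| ≤
      B * (5 * M * C) * T * √δ := by
  obtain ⟨N, -, hN⟩ := exists_bound_of_hasCompactSupport (ι := Unit) (f := fun _ => φ)
    (fun _ => hφ.smooth.continuous) (fun _ => hφ.hasCompactSupport)
  have hψm : AEStronglyMeasurable ψ (volume.restrict (Ioo 0 T)) :=
    (hψ.mono Ioo_subset_Icc_self).aestronglyMeasurable measurableSet_Ioo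
  have hψae : ∀ᵐ t ∂(volume.restrict (Ioo 0 T)), |ψ t| ≤ B :=
    (ae_restrict_iff' measurableSet_Ioo).2 (ae_of_all _ fun t ht => hB t (Ioo_subset_Icc_self ht))
  have hB0 : 0 ≤ B := (abs_nonneg _).trans (hB 0 (left_mem_Icc.2 hT.le))
  -- integrability on the product, for the slices and for the iterated integrals
  have hint : ∀ {F : Type} [NormedAddCommGroup F] (A : ℝ → Vec → F),
      MemLp (fun p : ℝ × Vec => A p.1 p.2) 2 (spaceTime T Ω) →
      Integrable (fun p : ℝ × Vec => ψ p.1 * φ p.2 * (δ * ‖A p.1 p.2‖ ^ 2)) (spaceTime T Ω) := by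
    intro F _ A hA
    refine (hA.norm.integrable_sq.const_mul δ).bdd_mul (c := B * N)
      (hψm.comp_fst.mul (hφ.smooth.continuous.comp continuous_snd).aestronglyMeasurable) ?_
    filter_upwards [Measure.quasiMeasurePreserving_fst.ae hψae] with p hp
    rw [norm_mul]
    exact mul_le_mul hp (hN () p.2) (norm_nonneg _) hB0
  have h1 := hint D2u hu.memLp_hess
  have h2 := hint (fun t x => lap (D2u t x)) (memLp_lap hu.memLp_hess)
  rw [← integral_sub h1.integral_prod_left h2.integral_prod_left]
  have hbd : ∀ᵐ t ∂(volume.restrict (Ioo 0 T)),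
      ‖(∫ x in Ω, ψ t * φ x * (δ * ‖D2u t x‖ ^ 2)) -
        ∫ x in Ω, ψ t * φ x * (δ * ‖lap (D2u t x)‖ ^ 2)‖ ≤ B * (5 * M * C) * √δ := by
    filter_upwards [h1.prod_right_ae, h2.prod_right_ae, hψae, hu.ae_isH2, hC]
      with t ht1 ht2 hψt hut hCt
    rw [← integral_sub ht1 ht2]
    have e : ∀ x, ψ t * φ x * (δ * ‖D2u t x‖ ^ 2) - ψ t * φ x * (δ * ‖lap (D2u t x)‖ ^ 2) =
        ψ t * δ * (φ x * (‖D2u t x‖ ^ 2 - ‖lap (D2u t x)‖ ^ 2)) := fun x => by ring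
    simp_rw [e]
    rw [integral_const_mul, Real.norm_eq_abs, abs_mul, abs_mul, abs_of_pos hδ]
    have hs : 0 < √δ := Real.sqrt_pos.2 hδ
    have hss : √δ * √δ = δ := Real.mul_self_sqrt hδ.le
    have hinv : δ * (√δ)⁻¹ = √δ := by
      nth_rewrite 1 [← hss]; field_simp
    -- the choice `ε = √δ` balances the two error terms
    have key := abs_integral_mul_norm_sq_hess_sub_le hΩ hut hφ hM hs
    have key' : δ * |∫ x in Ω, φ x * (‖D2u t x‖ ^ 2 - ‖lap (D2u t x)‖ ^ 2)| ≤ 5 * M * C * √δ := by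
      calc _ ≤ δ * (M * (3 * (√δ)⁻¹ * (∫ x in Ω, ‖Du t x‖ ^ 2) +
              2 * √δ * ∫ x in Ω, ‖D2u t x‖ ^ 2)) := mul_le_mul_of_nonneg_left key hδ.le
        _ = M * (3 * (δ * (√δ)⁻¹) * (∫ x in Ω, ‖Du t x‖ ^ 2) +
              2 * √δ * (δ * ∫ x in Ω, ‖D2u t x‖ ^ 2)) := by ring
        _ ≤ M * (3 * √δ * C + 2 * √δ * C) := by
            rw [hinv]
            gcongr
            · exact hCt.1
            · exact hCt.2
        _ = _ := by ring
    calc |ψ t| * δ * |∫ x in Ω, φ x * (‖D2u t x‖ ^ 2 - ‖lap (D2u t x)‖ ^ 2)|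
        = |ψ t| * (δ * |∫ x in Ω, φ x * (‖D2u t x‖ ^ 2 - ‖lap (D2u t x)‖ ^ 2)|) := by ring
      _ ≤ B * (5 * M * C * √δ) := mul_le_mul hψt key' (by positivity) hB0
      _ = _ := by ring
  have := norm_setIntegral_le_of_norm_le_const_ae' (μ := volume) (s := Ioo 0 T) (by simp)
    ((ae_restrict_iff' measurableSet_Ioo).1 hbd)
  rw [Real.norm_eq_abs] at this
  refine this.trans_eq ?_
  simp only [Measure.real, Real.volume_Ioo, sub_zero, ENNReal.toReal_ofReal hT.le]
  ring

end DefectMeasure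

theorem mainTheorem5
    (T : ℝ) (hT : 0 < T) (Ω : Set Vec) (hΩ : IsBoundedC31Domain Ω)
    -- a fixed `g ∈ H²(Ω)` that carries the common Dirichlet boundary values
    (g : Vec → Vec) (Dg : Vec → Mat) (D2g : Vec → Tens) (hg : IsH2 Ω g Dg D2g)
    -- the family `d δ t x`, with its weak spatial derivatives
    (d : ℝ → ℝ → Vec → Vec) (Dd : ℝ → ℝ → Vec → Mat) (D2d : ℝ → ℝ → Vec → Tens)
    (hd : ∀ δ ∈ Ioo (0 : ℝ) 1, IsL2H2 T Ω (d δ) (Dd δ) (D2d δ))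
    (hbdry : ∀ δ ∈ Ioo (0 : ℝ) 1, ∀ᵐ t ∂(volume.restrict (Ioo 0 T)),
      IsH10 Ω (d δ t - g) (Dd δ t - Dg))
    (hbound : ⨆ δ ∈ Ioo (0 : ℝ) 1,
      (ENNReal.ofReal δ * essSupTime T (fun t => sqNormL2 Ω fun x => lap (D2d δ t x)) +
        essSupTime T (fun t => sqNormL2 Ω (d δ t) + sqNormL2 Ω (Dd δ t))) < ⊤) :
    ∃ (δ : ℕ → ℝ) (μ : Kernel ℝ Vec) (ν : Kernel (Vec × ℝ) TensSphere),
      (∀ k, δ k ∈ Ioo (0 : ℝ) 1) ∧ StrictAnti δ ∧ Tendsto δ atTop (𝓝 0) ∧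
      IsDefectMeasure T Ω μ ν ∧
      (∀ f : Vec → ℝ → Tens → ℝ,
        ContinuousOn (fun p : Vec × ℝ × Tens => f p.1 p.2.1 p.2.2)
          (closure Ω ×ˢ Icc 0 T ×ˢ Metric.sphere (0 : Tens) 1) →
        Tendsto (fun k => ∫ t in Ioo 0 T, ∫ x in Ω,
            f x t (‖D2d (δ k) t x‖⁻¹ • D2d (δ k) t x) * (δ k * ‖D2d (δ k) t x‖ ^ 2))
          atTop
          (𝓝 (∫ t in Ioo 0 T, ∫ x in closure Ω, ∫ Γ : TensSphere, f x t Γ ∂(ν (x, t)) ∂(μ t)))) ∧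
      (∀ (ψ : ℝ → ℝ) (φ : Vec → ℝ), ContinuousOn ψ (Icc 0 T) → IsTestFunction Ω φ →
        Tendsto (fun k => ∫ t in Ioo 0 T, ∫ x in Ω,
            ψ t * φ x * (δ k * ‖D2d (δ k) t x‖ ^ 2))
          atTop (𝓝 (∫ t in Ioo 0 T, ∫ x in closure Ω, ψ t * φ x ∂(μ t))) ∧
        Tendsto (fun k => ∫ t in Ioo 0 T, ∫ x in Ω,
            ψ t * φ x * (δ k * ‖lap (D2d (δ k) t x)‖ ^ 2))
          atTop (𝓝 (∫ t in Ioo 0 T, ∫ x in closure Ω, ψ t * φ x ∂(μ t)))) := by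
  obtain ⟨C, hC0, hC⟩ := exists_uniform_bound hΩ hg hd hbdry hbound
  set δ₀ : ℕ → ℝ := fun n => 1 / ((n : ℝ) + 2) with hδ₀
  have hmem₀ : ∀ n, δ₀ n ∈ Ioo (0 : ℝ) 1 := by
    intro n
    have hn : (0 : ℝ) ≤ n := n.cast_nonneg
    exact ⟨by positivity, by rw [hδ₀, div_lt_one (by positivity)]; linarith⟩
  have hanti₀ : StrictAnti δ₀ := by
    intro m n hmn
    have : (m : ℝ) < n := by exact_mod_cast hmn
    exact one_div_lt_one_div_of_lt (by positivity) (by linarith)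
  have hlim₀ : Tendsto δ₀ atTop (𝓝 0) :=
    tendsto_const_nhds.div_atTop
      (tendsto_atTop_add_const_right _ _ tendsto_natCast_atTop_atTop)
  obtain ⟨σ, μ, ν, hσ, hμν, hlim⟩ := exists_subseq_isDefectMeasure hT
    hΩ.isOpen.measurableSet hΩ.isConnected.nonempty hΩ.isBounded (C := C.toNNReal) δ₀
    (fun n => (hmem₀ n).1.le) (fun n => D2d (δ₀ n)) (fun n => (hd _ (hmem₀ n)).memLp_hess)
    (fun n => by
      filter_upwards [hC _ (hmem₀ n), (hd _ (hmem₀ n)).ae_isH2] with t ht hut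
      rw [← ofReal_integral_eq_lintegral_ofReal (hut.memLp_hess.norm.integrable_sq.const_mul _)
        (ae_of_all _ fun x => mul_nonneg (hmem₀ n).1.le (by positivity)), integral_const_mul]
      exact ENNReal.ofReal_le_ofReal ht.2)
  have := hμν.markov
  have hlimσ : Tendsto (fun k => δ₀ (σ k)) atTop (𝓝 0) := hlim₀.comp hσ.tendsto_atTop
  refine ⟨fun k => δ₀ (σ k), μ, ν, fun k => hmem₀ _, hanti₀.comp_strictMono hσ, hlimσ, hμν, hlim,
    fun ψ φ hψ hφ => ?_⟩
  have hfirst : Tendsto (fun k => ∫ t in Ioo 0 T, ∫ x in Ω,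
      ψ t * φ x * (δ₀ (σ k) * ‖D2d (δ₀ (σ k)) t x‖ ^ 2)) atTop
      (𝓝 (∫ t in Ioo 0 T, ∫ x in closure Ω, ψ t * φ x ∂(μ t))) := by
    have h := hlim (fun x t _ => ψ t * φ x)
      ((hψ.comp (f := fun p : Vec × ℝ × Tens => p.2.1) (by fun_prop) fun p hp => hp.2.1).mul
        (hφ.smooth.continuous.comp continuous_fst).continuousOn)
    simpa using h
  refine ⟨hfirst, ?_⟩
  obtain ⟨B, hB⟩ := isCompact_Icc.exists_bound_of_continuousOn hψ
  obtain ⟨M, hM0, hM⟩ := exists_bound_of_hasCompactSupport (f := fun i => pderiv i φ)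
    (fun i => (hφ.pderiv i).smooth.continuous) (fun i => (hφ.pderiv i).hasCompactSupport)
  have hdiff : Tendsto (fun k =>
      (∫ t in Ioo 0 T, ∫ x in Ω, ψ t * φ x * (δ₀ (σ k) * ‖D2d (δ₀ (σ k)) t x‖ ^ 2)) -
      ∫ t in Ioo 0 T, ∫ x in Ω, ψ t * φ x * (δ₀ (σ k) * ‖lap (D2d (δ₀ (σ k)) t x)‖ ^ 2))
      atTop (𝓝 0) := by
    refine squeeze_zero_norm (a := fun k => B * (5 * M * C) * T * √(δ₀ (σ k))) (fun k => ?_) ?_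
    · exact abs_integral_hess_sub_integral_lap_le hT hΩ.isOpen (hd _ (hmem₀ _)) (hmem₀ _).1
        (hC _ (hmem₀ _)) hψ hφ hB hM0 hM
    · simpa using ((Real.continuous_sqrt.tendsto _).comp hlimσ).const_mul (B * (5 * M * C) * T)
  simpa using hfirst.sub hdiff
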